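/- Let $\lambda=\sqrt[3]{24}$. Let $G$ be a finite solvable group, let $k$ be a field of characteristic $p>0$, and let $V\neq 0$ be a finite, faithful, completely reducible $G$-module over $k$ (that is, a $k$-vector space with finitely many elements on which $G$ acts $k$-linearly and faithfully, such that every $G$-invariant subspace has a $G$-invariant complement). Let $H$ be any subgroup of $G$ (the action of $H$ on $V$ need not be completely reducible). (1) If $2\nmid |H|$ or $3\nmid |H|$, then $|H|\leq |V|^2/\lambda$. (2) If $2\nmid |H|$ and $p\neq 2$, then $|H|\leq |V|^{3/2}/\lambda$. -/

import Mathlib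

/-- The constant `λ`, the real cube root of `24`. -/
noncomputable def lam : ℝ := (24 : ℝ) ^ (1 / 3 : ℝ)

/-!
Only the part of `|G|` prime to `2`, or to `3`, matters, because `|H|` divides it. These parts are
bounded for every solvable `G`, with the two exponents and the constant `λ` of the theorem
(`OrderBound`); the notation `ordCompl[q] n` stands for the part of `n` prime to `q`.

*Reduction to irreducible actions.* Let the scalars `kˣ` join the group. Then `V` is a direct sum of
irreducible actions on abelian groups, with no field in sight, and `G` embeds into the product of
the groups induced on the summands (`OrderBound.of_isSemisimpleModule`). Irreducible actions are
treated by induction on `|V|` (`boundBelow`).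

*Imprimitive case* (`SharpOrderBound.of_not_isotypic`). If the restriction to some normal subgroup
is not isotypic, Clifford's theorem gives `n > 1` components that `G` permutes transitively, and
each stabilizer acts irreducibly on its component. The solvable group permuting the components has
order at most `λ ^ (n - 1)` (`card_solvable_perm_pow_three_le`, Dixon's bound), which is what the
product of `n` bounds with the constant `1 / λ` leaves room for.

*Primitive case* (`SharpOrderBound.of_isotypic`). Otherwise let `Z` be a maximal abelian normal
subgroup. It generates a field `F` of scalars on `V`, and `G` modulo the centralizer `C` of `Z` acts
on `F` by automorphisms. If `C = Z`, then `G` is a group of semilinear maps of a line, of order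
dividing `(|F| - 1) * [F : 𝔽_p]`. If not, let `M / Z` be minimal normal in `G / Z` and contained in
`C / Z`. The commutator pairing makes `M / Z` a symplectic space over a prime field, of order
`e ^ 2` (`exists_card_sq_eq`). Let `D` be the centralizer of `M`. As a `D`-module, `V` is `Y ^ t`
with `Y` simple, and the nondegenerate pairing makes coset representatives of `Z` in `M` linearly
independent in the ring of matrices of size `t` over `End Y`, so that `e ≤ t`
(`exists_simple_summand`). Now `|G|` divides the product of four numbers: the order of the group
induced on `M / Z`, which acts irreducibly and falls under the induction; the degree of `F` over its
prime field; the order `e ^ 2` of the group of characters of `M / Z`; and `|D|`, bounded by the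
induction applied to `Y`. The inequalities then close numerically (`SharpOrderBound.of_primitive`),
the tight cases being small `e`. For `e = 2` and `e = 4` the induction has to carry sharper bounds
on the part prime to `3` for modules of order `4` and `16`, which is the point of `SharpOrderBound`.
-/

/-! ### Numerical bounds -/

/-- The numerical conclusion for a solvable group inducing a group of order `n` on a group of order
`v`: with `g` the part of `n` prime to `2` (or to `3`), the bound `g ≤ v ^ 2 / λ` reads
`24 * g ^ 3 ≤ v ^ 6`, and `g ≤ v ^ (3 / 2) / λ` reads `576 * g ^ 6 ≤ v ^ 9`. -/
structure OrderBound (v n : ℕ) : Prop where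
  two : 24 * (ordCompl[2] n) ^ 3 ≤ v ^ 6
  three : 24 * (ordCompl[3] n) ^ 3 ≤ v ^ 6
  odd : Odd v → 576 * (ordCompl[2] n) ^ 6 ≤ v ^ 9

/-- The bounds of `OrderBound`, sharpened at `v = 4` and `v = 16`. For irreducible actions the
sharper bounds hold as well, and the induction needs them when the extraspecial section has order
`4` or `16`. -/
structure SharpOrderBound (v n : ℕ) : Prop extends OrderBound v n where
  four : v = 4 → ordCompl[3] n ≤ 2
  sixteen : v = 16 → ordCompl[3] n ≤ 40

theorem ordCompl_le_of_dvd (q : ℕ) {a b : ℕ} (hb : b ≠ 0) (h : a ∣ b) :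
    ordCompl[q] a ≤ ordCompl[q] b :=
  Nat.le_of_dvd (Nat.ordCompl_pos q hb) (Nat.ordCompl_dvd_ordCompl_of_dvd h q)

theorem OrderBound.of_dvd {v n m : ℕ} (h : OrderBound v m) (hm : m ≠ 0) (hn : n ∣ m) :
    OrderBound v n where
  two := (Nat.mul_le_mul_left _ (Nat.pow_le_pow_left (ordCompl_le_of_dvd 2 hm hn) _)).trans h.two
  three :=
    (Nat.mul_le_mul_left _ (Nat.pow_le_pow_left (ordCompl_le_of_dvd 3 hm hn) _)).trans h.three
  odd hv :=
    (Nat.mul_le_mul_left _ (Nat.pow_le_pow_left (ordCompl_le_of_dvd 2 hm hn) _)).trans (h.odd hv)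

theorem SharpOrderBound.of_dvd {v n m : ℕ} (h : SharpOrderBound v m) (hm : m ≠ 0) (hn : n ∣ m) :
    SharpOrderBound v n where
  toOrderBound := h.toOrderBound.of_dvd hm hn
  four hv := (ordCompl_le_of_dvd 3 hm hn).trans (h.four hv)
  sixteen hv := (ordCompl_le_of_dvd 3 hm hn).trans (h.sixteen hv)

theorem two_mul_le_pow {p a : ℕ} (hp : 2 ≤ p) : 2 * a ≤ p ^ a := by
  have h : 2 * a ≤ 2 ^ a := by
    rcases a with _ | a
    · simp
    · have := Nat.lt_two_pow_self (n := a)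
      rw [pow_succ]; omega
  exact h.trans (Nat.pow_le_pow_left hp a)

theorem ordCompl_self_pow {q : ℕ} (hq : q.Prime) (m : ℕ) : ordCompl[q] (q ^ m) = 1 := by
  rw [hq.factorization_pow, Finsupp.single_eq_same, Nat.div_self (pow_pos hq.pos m)]

/-- With `pow_eight_le` and `pow_ten_le`, the growth estimates that settle the primitive case for
all but finitely many `e`. -/
theorem pow_six_le {e u : ℕ} (h : 6 ≤ e ∧ 3 ≤ u ∨ e = 5 ∧ 6 ≤ u) : e ^ 6 ≤ 4 * u ^ (2 * e - 3) := by
  rcases h with ⟨he, hu⟩ | ⟨rfl, hu⟩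
  · refine le_trans ?_ (Nat.mul_le_mul_left 4 (Nat.pow_le_pow_left hu _))
    induction e, he using Nat.le_induction with
    | base => norm_num
    | succ e he ih =>
      rw [show 2 * (e + 1) - 3 = 2 * e - 3 + 2 by omega, pow_add]
      have h1 : 6 * (e + 1) ≤ 7 * e := by omega
      have h2 : 6 ^ 6 * (e + 1) ^ 6 ≤ 7 ^ 6 * e ^ 6 := by
        rw [← mul_pow, ← mul_pow]; exact Nat.pow_le_pow_left h1 6
      omega
  · exact le_trans (by norm_num) (Nat.mul_le_mul_left 4 (Nat.pow_le_pow_left hu _))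

theorem pow_eight_le {e u : ℕ} (he : 5 ≤ e) (hu : 3 ≤ u) : e ^ 8 ≤ 16 * u ^ (3 * e - 5) := by
  refine le_trans ?_ (Nat.mul_le_mul_left 16 (Nat.pow_le_pow_left hu _))
  induction e, he using Nat.le_induction with
  | base => norm_num
  | succ e he ih =>
    rw [show 3 * (e + 1) - 5 = 3 * e - 5 + 3 by omega, pow_add]
    have h1 : 5 * (e + 1) ≤ 6 * e := by omega
    have h2 : 5 ^ 8 * (e + 1) ^ 8 ≤ 6 ^ 8 * e ^ 8 := by
      rw [← mul_pow, ← mul_pow]; exact Nat.pow_le_pow_left h1 8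
    omega

theorem pow_ten_le {e u : ℕ} (h : 7 ≤ e ∧ 3 ≤ u ∨ e = 5 ∧ 6 ≤ u ∨ e = 3 ∧ 7 ≤ u) :
    e ^ 10 ≤ 32 * u ^ (3 * e - 5) := by
  rcases h with ⟨he, hu⟩ | ⟨rfl, hu⟩ | ⟨rfl, hu⟩
  · refine le_trans ?_ (Nat.mul_le_mul_left 32 (Nat.pow_le_pow_left hu _))
    induction e, he using Nat.le_induction with
    | base => norm_num
    | succ e he ih =>
      rw [show 3 * (e + 1) - 5 = 3 * e - 5 + 3 by omega, pow_add]
      have h1 : 7 * (e + 1) ≤ 8 * e := by omega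
      have h2 : 7 ^ 10 * (e + 1) ^ 10 ≤ 8 ^ 10 * e ^ 10 := by
        rw [← mul_pow, ← mul_pow]; exact Nat.pow_le_pow_left h1 10
      omega
  · exact le_trans (by norm_num) (Nat.mul_le_mul_left 32 (Nat.pow_le_pow_left hu _))
  · exact le_trans (by norm_num) (Nat.mul_le_mul_left 32 (Nat.pow_le_pow_left hu _))

theorem mul_le_pow_of_pow_six_le {x a e u : ℕ} (he : 2 ≤ e) (hx : 24 * x ^ 3 ≤ (e ^ 2) ^ 6)
    (ha : 2 * a ≤ u) (h : e ^ 6 ≤ 4 * u ^ (2 * e - 3)) : x * a * e ^ 2 ≤ u ^ (2 * (e - 1)) := by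
  have hx' : 2 * x ≤ e ^ 4 := by
    refine (Nat.pow_le_pow_iff_left (n := 3) (by norm_num)).1 ?_
    have : (e ^ 2) ^ 6 = (e ^ 4) ^ 3 := by ring
    rw [mul_pow]; omega
  have h1 : 2 * x * (2 * a) * e ^ 2 ≤ e ^ 4 * u * e ^ 2 := by gcongr
  have h2 : e ^ 4 * u * e ^ 2 ≤ 4 * u ^ (2 * e - 3) * u := by
    calc e ^ 4 * u * e ^ 2 = e ^ 6 * u := by ring
      _ ≤ _ := by gcongr
  have h3 : u ^ (2 * (e - 1)) = u ^ (2 * e - 3) * u := by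
    rw [← pow_succ]; congr 1; omega
  rw [h3]; nlinarith

theorem le_of_cube_le {x c b : ℕ} (hx : 24 * x ^ 3 ≤ c) (hb : c < 24 * (b + 1) ^ 3) : x ≤ b := by
  by_contra! h
  have : (b + 1) ^ 3 ≤ x ^ 3 := Nat.pow_le_pow_left h 3
  omega

/-- The inequality behind the primitive case, for the part prime to `2`. -/
theorem ordCompl_two_mul_le {r m e u p a x : ℕ} (hr : r.Prime) (he : e = r ^ m)
    (h2 : 2 ≤ e) (hru : r ∣ u - 1) (hu : u = p ^ a) (hp : 2 ≤ p) (hu3 : 3 ≤ u)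
    (hx : 24 * (ordCompl[2] x) ^ 3 ≤ (e ^ 2) ^ 6) :
    ordCompl[2] x * ordCompl[2] a * ordCompl[2] (e ^ 2) ≤ u ^ (2 * (e - 1)) := by
  have ha : 2 * a ≤ u := hu ▸ two_mul_le_pow hp
  have hoa : ordCompl[2] a ≤ a := Nat.ordCompl_le a 2
  have hoe : ordCompl[2] (e ^ 2) ≤ e ^ 2 := Nat.ordCompl_le _ 2
  have hor : r = 2 → ordCompl[2] (e ^ 2) = 1 := by
    rintro rfl; rw [he, ← pow_mul]; exact ordCompl_self_pow Nat.prime_two _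
  generalize ordCompl[2] x = x' at *
  by_cases hbig : 6 ≤ e ∨ e = 5
  · have h5 : 6 ≤ e ∧ 3 ≤ u ∨ e = 5 ∧ 6 ≤ u := by
      rcases hbig with h | h
      · exact Or.inl ⟨h, hu3⟩
      · refine Or.inr ⟨h, ?_⟩
        have : r = 5 := by
          have h5 : (5 : ℕ).Prime := by norm_num
          have := h5.dvd_of_dvd_pow (show 5 ∣ r ^ m by rw [← he, h])
          exact ((Nat.prime_dvd_prime_iff_eq h5 hr).1 this).symm
        subst this
        have := Nat.le_of_dvd (by omega) hru
        omega
    refine le_trans ?_ (mul_le_pow_of_pow_six_le h2 hx ha (pow_six_le h5))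
    gcongr
  push Not at hbig
  have : e = 2 ∨ e = 3 ∨ e = 4 := by omega
  rcases this with rfl | rfl | rfl
  · have hr2 : r = 2 :=
      ((Nat.prime_dvd_prime_iff_eq Nat.prime_two hr).1
        (Nat.prime_two.dvd_of_dvd_pow (show 2 ∣ r ^ m by rw [← he]))).symm
    rw [hor hr2]
    have hx5 : x' ≤ 5 := le_of_cube_le hx (by norm_num)
    have : x' * ordCompl[2] a ≤ 5 * a := Nat.mul_le_mul hx5 hoa
    norm_num
    nlinarith
  · have hr3 : r = 3 :=
      ((Nat.prime_dvd_prime_iff_eq Nat.prime_three hr).1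
        (Nat.prime_three.dvd_of_dvd_pow (show 3 ∣ r ^ m by rw [← he]))).symm
    subst hr3
    have hx28 : x' ≤ 28 := le_of_cube_le hx (by norm_num)
    have hle : x' * ordCompl[2] a * ordCompl[2] (3 ^ 2) ≤ 28 * ordCompl[2] a * 3 ^ 2 := by gcongr
    refine hle.trans ?_
    have hu4 : u = 4 ∨ 6 ≤ u := by
      have := Nat.le_of_dvd (by omega) hru
      by_contra! h
      have : u = 5 := by omega
      subst this
      revert hru; decide
    rcases hu4 with rfl | hu6
    -- The tight case: `u = 4` forces `a ≤ 2`, and the odd part of `a` is `1`.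
    · have : ordCompl[2] a ≤ 1 := by
        have ha2 : a ≤ 2 := by omega
        interval_cases a
        · simp
        · simp
        · have := ordCompl_self_pow Nat.prime_two 1
          simpa using this.le
      norm_num
      omega
    · have h36 : 36 ≤ u ^ 2 := by nlinarith
      have : u ^ (2 * (3 - 1)) = u ^ 2 * u ^ 2 := by norm_num; ring
      rw [this]
      nlinarith
  · have hr2 : r = 2 :=
      ((Nat.prime_dvd_prime_iff_eq Nat.prime_two hr).1
        (Nat.prime_two.dvd_of_dvd_pow (show 2 ∣ r ^ m by rw [← he]; norm_num))).symm
    rw [hor hr2]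
    have hx88 : x' ≤ 128 := le_of_cube_le hx (by norm_num)
    have h3 : x' * ordCompl[2] a ≤ 128 * a := Nat.mul_le_mul hx88 hoa
    have h4 : 3 ^ 5 ≤ u ^ 5 := Nat.pow_le_pow_left hu3 5
    have : u ^ (2 * (4 - 1)) = u ^ 5 * u := by norm_num; ring
    rw [this]
    nlinarith

/-- The inequality behind the primitive case, for the part prime to `3`. -/
theorem ordCompl_three_mul_le {r m e u p a x : ℕ} (hr : r.Prime) (he : e = r ^ m)
    (h2 : 2 ≤ e) (hru : r ∣ u - 1) (hu : u = p ^ a) (hp : 2 ≤ p) (hu3 : 3 ≤ u)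
    (hx : 24 * (ordCompl[3] x) ^ 3 ≤ (e ^ 2) ^ 6) (hx4 : e ^ 2 = 4 → ordCompl[3] x ≤ 2)
    (hx16 : e ^ 2 = 16 → ordCompl[3] x ≤ 40) :
    ordCompl[3] x * ordCompl[3] a * ordCompl[3] (e ^ 2) ≤ u ^ (2 * (e - 1)) := by
  have ha : 2 * a ≤ u := hu ▸ two_mul_le_pow hp
  have hoa : ordCompl[3] a ≤ a := Nat.ordCompl_le a 3
  have hoe : ordCompl[3] (e ^ 2) ≤ e ^ 2 := Nat.ordCompl_le _ 3
  have hor : r = 3 → ordCompl[3] (e ^ 2) = 1 := by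
    rintro rfl; rw [he, ← pow_mul]; exact ordCompl_self_pow Nat.prime_three _
  generalize ordCompl[3] x = x' at *
  by_cases hbig : 6 ≤ e ∨ e = 5
  · have h5 : 6 ≤ e ∧ 3 ≤ u ∨ e = 5 ∧ 6 ≤ u := by
      rcases hbig with h | h
      · exact Or.inl ⟨h, hu3⟩
      · refine Or.inr ⟨h, ?_⟩
        have : r = 5 := by
          have h5 : (5 : ℕ).Prime := by norm_num
          have := h5.dvd_of_dvd_pow (show 5 ∣ r ^ m by rw [← he, h])
          exact ((Nat.prime_dvd_prime_iff_eq h5 hr).1 this).symm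
        subst this
        have := Nat.le_of_dvd (by omega) hru
        omega
    refine le_trans ?_ (mul_le_pow_of_pow_six_le h2 hx ha (pow_six_le h5))
    gcongr
  push Not at hbig
  have : e = 2 ∨ e = 3 ∨ e = 4 := by omega
  rcases this with rfl | rfl | rfl
  · have hx2 : x' ≤ 2 := hx4 (by norm_num)
    have : x' * ordCompl[3] a * ordCompl[3] (2 ^ 2) ≤ 2 * a * 2 ^ 2 := by gcongr
    refine this.trans ?_
    norm_num
    rcases (show u = 3 ∨ 4 ≤ u by omega) with rfl | h
    · omega
    · nlinarith
  · have hr3 : r = 3 :=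
      ((Nat.prime_dvd_prime_iff_eq Nat.prime_three hr).1
        (Nat.prime_three.dvd_of_dvd_pow (show 3 ∣ r ^ m by rw [← he]))).symm
    rw [hor hr3]
    have hx28 : x' ≤ 28 := le_of_cube_le hx (by norm_num)
    have h3 : x' * ordCompl[3] a ≤ 28 * a := Nat.mul_le_mul hx28 hoa
    have h4 : 3 ^ 3 ≤ u ^ 3 := Nat.pow_le_pow_left hu3 3
    have : u ^ (2 * (3 - 1)) = u ^ 3 * u := by norm_num; ring
    rw [this]
    nlinarith
  · have hx40 : x' ≤ 40 := hx16 (by norm_num)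
    have : x' * ordCompl[3] a * ordCompl[3] (4 ^ 2) ≤ 40 * a * 4 ^ 2 := by gcongr
    refine this.trans ?_
    have h6 : u ^ (2 * (4 - 1)) = u ^ 5 * u := by norm_num; ring
    rw [h6]
    rcases (show u = 3 ∨ 4 ≤ u by omega) with rfl | h
    · omega
    · have h4 : 4 ^ 5 ≤ u ^ 5 := Nat.pow_le_pow_left h 5
      nlinarith

/-- The inequality behind the primitive case in odd characteristic, for the part prime to `2`. -/
theorem ordCompl_two_mul_sq_le {r m e u p a x : ℕ} (hr : r.Prime) (he : e = r ^ m)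
    (h2 : 2 ≤ e) (hru : r ∣ u - 1) (hu : u = p ^ a) (hp : 2 ≤ p) (hu3 : 3 ≤ u) (huo : Odd u)
    (hx : 24 * (ordCompl[2] x) ^ 3 ≤ (e ^ 2) ^ 6)
    (hxo : Odd (e ^ 2) → 576 * (ordCompl[2] x) ^ 6 ≤ (e ^ 2) ^ 9) :
    (ordCompl[2] x * ordCompl[2] a * ordCompl[2] (e ^ 2)) ^ 2 ≤ u ^ (3 * (e - 1)) := by
  have ha : 2 * a ≤ u := hu ▸ two_mul_le_pow hp
  have hoa : ordCompl[2] a ≤ a := Nat.ordCompl_le a 2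
  have hoe : ordCompl[2] (e ^ 2) ≤ e ^ 2 := Nat.ordCompl_le _ 2
  have hor : r = 2 → ordCompl[2] (e ^ 2) = 1 := by
    rintro rfl; rw [he, ← pow_mul]; exact ordCompl_self_pow Nat.prime_two _
  generalize ordCompl[2] x = x' at *
  have hex : u ^ (3 * (e - 1)) = u ^ (3 * e - 5) * u ^ 2 := by
    rw [← pow_add]; congr 1; omega
  have ha2 : 4 * a ^ 2 ≤ u ^ 2 := by nlinarith
  rcases hr.eq_two_or_odd' with hr2 | hro
  · rw [hor hr2, mul_one]
    have hle : (x' * ordCompl[2] a) ^ 2 ≤ (x' * a) ^ 2 := by gcongr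
    refine hle.trans ?_
    by_cases hbig : 5 ≤ e
    · have h8 := pow_eight_le hbig hu3
      have hx' : 2 * x' ≤ e ^ 4 := by
        refine (Nat.pow_le_pow_iff_left (n := 3) (by norm_num)).1 ?_
        have : (e ^ 2) ^ 6 = (e ^ 4) ^ 3 := by ring
        rw [mul_pow]; omega
      have h1 : (2 * x') ^ 2 * (4 * a ^ 2) ≤ (e ^ 4) ^ 2 * u ^ 2 := by gcongr
      have h3 : (e ^ 4) ^ 2 * u ^ 2 ≤ 16 * u ^ (3 * e - 5) * u ^ 2 := by
        rw [← pow_mul]; gcongr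
      rw [hex]
      nlinarith
    have he24 : e = 2 ∨ e = 4 := by
      rcases (show e = 2 ∨ e = 3 ∨ e = 4 by omega) with h | h | h
      · exact Or.inl h
      · have := Nat.prime_three.dvd_of_dvd_pow (show 3 ∣ r ^ m by rw [← he, h])
        rw [hr2] at this; omega
      · exact Or.inr h
    rcases he24 with rfl | rfl
    · have hx5 : x' ≤ 5 := le_of_cube_le hx (by norm_num)
      have h1 : (x' * a) ^ 2 ≤ (5 * a) ^ 2 := by gcongr
      refine h1.trans ?_
      norm_num
      rcases (show u = 3 ∨ u = 4 ∨ u = 5 ∨ 7 ≤ u ∨ u = 6 by omega) with rfl | rfl | rfl | h | rfl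
      · have : a ≤ 1 := by omega
        interval_cases a <;> norm_num
      · exact absurd huo (by decide)
      · have : a ≤ 2 := by omega
        interval_cases a <;> norm_num
      · nlinarith [mul_le_mul h (le_refl (u ^ 2)) (Nat.zero_le _) (Nat.zero_le _)]
      · exact absurd huo (by decide)
    · have hx128 : x' ≤ 128 := le_of_cube_le hx (by norm_num)
      have h1 : (x' * a) ^ 2 ≤ (128 * a) ^ 2 := by gcongr
      refine h1.trans ?_
      rcases (show u = 3 ∨ 4 ≤ u by omega) with rfl | h
      · have : a ≤ 1 := by omega
        interval_cases a <;> norm_num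
      · have h4 : 4 ^ 7 ≤ u ^ 7 := Nat.pow_le_pow_left h 7
        rw [hex]
        norm_num at h4 ⊢
        nlinarith
  · have hxo' := hxo (he ▸ (hro.pow).pow)
    have hx' : 8 * x' ^ 2 ≤ e ^ 6 := by
      refine (Nat.pow_le_pow_iff_left (n := 3) (by norm_num)).1 ?_
      have h1 : (e ^ 2) ^ 9 = (e ^ 6) ^ 3 := by ring
      have h3 : (8 * x' ^ 2) ^ 3 = 512 * x' ^ 6 := by ring
      omega
    have hcase : 7 ≤ e ∧ 3 ≤ u ∨ e = 5 ∧ 6 ≤ u ∨ e = 3 ∧ 7 ≤ u := by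
      have heo : Odd e := he ▸ hro.pow
      have hpr : ∀ q : ℕ, q.Prime → e = q → r = q := fun q hq h =>
        ((Nat.prime_dvd_prime_iff_eq hq hr).1 (hq.dvd_of_dvd_pow
          (show q ∣ r ^ m by rw [← he, h]))).symm
      by_cases h7 : 7 ≤ e
      · exact Or.inl ⟨h7, hu3⟩
      have : e = 3 ∨ e = 5 := by
        obtain ⟨k, hk⟩ := heo
        omega
      rcases this with h | h
      · have hr3 := hpr 3 (by norm_num) h
        subst hr3
        obtain ⟨k, hk⟩ := hru
        obtain ⟨l, hl⟩ := huo
        omega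
      · have hr5 := hpr 5 (by norm_num) h
        subst hr5
        have := Nat.le_of_dvd (by omega) hru
        omega
    have h10 := pow_ten_le hcase
    have h1 : (x' * ordCompl[2] a * ordCompl[2] (e ^ 2)) ^ 2 ≤ (x' * a * e ^ 2) ^ 2 := by gcongr
    refine h1.trans ?_
    have h3 : 8 * x' ^ 2 * (4 * a ^ 2) * e ^ 4 ≤ e ^ 6 * u ^ 2 * e ^ 4 := by gcongr
    have h4 : e ^ 6 * u ^ 2 * e ^ 4 ≤ 32 * u ^ (3 * e - 5) * u ^ 2 := by
      calc e ^ 6 * u ^ 2 * e ^ 4 = e ^ 10 * u ^ 2 := by ring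
        _ ≤ _ := by gcongr
    rw [hex]
    nlinarith

/-- The numerical step for a primitive action: `u` is the order of the field of scalars, `a` its
degree, `e ^ 2` the order of the extraspecial section, `x` and `d` the orders of the groups induced
on that section and on a summand of order `y`. -/
theorem SharpOrderBound.of_primitive {r m e u p a x y d t v n : ℕ} (hr : r.Prime) (he : e = r ^ m)
    (h2 : 2 ≤ e) (hru : r ∣ u - 1) (hu : u = p ^ a) (hp : 2 ≤ p) (hu3 : 3 ≤ u)
    (hyu : u ≤ y) (het : e ≤ t) (hv : v = y ^ t) (huv : u ∣ v)
    (hx : SharpOrderBound (e ^ 2) x) (hd : OrderBound y d)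
    (hn : n ∣ x * a * e ^ 2 * d) (h0 : x * a * e ^ 2 * d ≠ 0) : SharpOrderBound v n := by
  refine SharpOrderBound.of_dvd ?_ h0 hn
  have hy0 : 0 < y := by omega
  have hle : ∀ k, u ^ (k * (e - 1)) ≤ y ^ (k * (t - 1)) := fun k =>
    (Nat.pow_le_pow_left hyu _).trans (Nat.pow_le_pow_right hy0 (by gcongr))
  have hsplit : ∀ k, v ^ k = y ^ (k * (t - 1)) * y ^ k := fun k => by
    rw [hv, ← pow_mul, ← pow_add]; congr 1
    obtain ⟨s, rfl⟩ : ∃ s, t = s + 1 := ⟨t - 1, by omega⟩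
    simp; ring
  have h9 : 9 ≤ v := by
    calc 9 = 3 ^ 2 := by norm_num
      _ ≤ y ^ 2 := Nat.pow_le_pow_left (by omega) 2
      _ ≤ v := hv ▸ Nat.pow_le_pow_right hy0 (by omega)
  refine ⟨⟨?_, ?_, fun hodd => ?_⟩, fun h => by omega, fun h => ?_⟩
  · rw [Nat.ordCompl_mul, Nat.ordCompl_mul, Nat.ordCompl_mul, mul_pow]
    have h1 := (ordCompl_two_mul_le hr he h2 hru hu hp hu3 hx.two).trans (hle 2)
    have h3 := Nat.pow_le_pow_left h1 3
    rw [← pow_mul] at h3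
    rw [hsplit 6, show 6 * (t - 1) = 2 * (t - 1) * 3 by ring]
    calc _ = _ * (24 * ordCompl[2] d ^ 3) := by ring
      _ ≤ _ := Nat.mul_le_mul h3 hd.two
  · rw [Nat.ordCompl_mul, Nat.ordCompl_mul, Nat.ordCompl_mul, mul_pow]
    have h1 := (ordCompl_three_mul_le hr he h2 hru hu hp hu3 hx.three hx.four hx.sixteen).trans
      (hle 2)
    have h3 := Nat.pow_le_pow_left h1 3
    rw [← pow_mul] at h3
    rw [hsplit 6, show 6 * (t - 1) = 2 * (t - 1) * 3 by ring]
    calc _ = _ * (24 * ordCompl[3] d ^ 3) := by ring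
      _ ≤ _ := Nat.mul_le_mul h3 hd.three
  · rw [Nat.ordCompl_mul, Nat.ordCompl_mul, Nat.ordCompl_mul, mul_pow]
    have hyo : Odd y := by
      rw [hv] at hodd
      exact Odd.of_dvd_nat hodd (dvd_pow_self y (by omega))
    have h1 := (ordCompl_two_mul_sq_le hr he h2 hru hu hp hu3 (Odd.of_dvd_nat hodd huv)
      hx.two hx.odd).trans (hle 3)
    have h3 := Nat.pow_le_pow_left h1 3
    rw [← pow_mul, ← pow_mul] at h3
    rw [hsplit 9, show 9 * (t - 1) = 3 * (t - 1) * 3 by ring]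
    calc _ = _ * (576 * ordCompl[2] d ^ 6) := by ring
      _ ≤ _ := Nat.mul_le_mul h3 (hd.odd hyo)
  · -- `u` divides `16`, so `r` is odd and `y ^ t ≥ 4 ^ 3`.
    exfalso
    rw [h] at huv
    have hr3 : 3 ≤ r := by
      rcases hr.eq_two_or_odd' with rfl | hro
      · have hu16 := Nat.le_of_dvd (by norm_num) huv
        interval_cases u <;> omega
      · obtain ⟨k, hk⟩ := hro
        have := hr.two_le
        omega
    have hre : r ≤ e := by
      have hm : m ≠ 0 := by rintro rfl; simp at he; omega
      exact he ▸ Nat.le_self_pow hm r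
    have hru' := Nat.le_of_dvd (by omega) hru
    have : 4 ^ 3 ≤ y ^ t :=
      (Nat.pow_le_pow_left (by omega) 3).trans (Nat.pow_le_pow_right hy0 (by omega))
    omega

theorem ordCompl_pow_mul_le {q : ℕ} (hq : q.Prime) (k b : ℕ) : ordCompl[q] (q ^ k * b) ≤ b := by
  rw [Nat.ordCompl_mul, ordCompl_self_pow hq, one_mul]
  exact Nat.ordCompl_le b q

theorem cube_le_eight_pow {a : ℕ} (ha : 4 ≤ a) : 24 * a ^ 3 ≤ 8 ^ a := by
  induction a, ha using Nat.le_induction with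
  | base => norm_num
  | succ a ha ih =>
    have h2 : 64 * (a + 1) ^ 3 ≤ 125 * a ^ 3 := by
      have := Nat.pow_le_pow_left (show 4 * (a + 1) ≤ 5 * a by omega) 3
      rw [mul_pow, mul_pow] at this; omega
    rw [pow_succ 8]; omega

theorem pow_six_le_pow {a : ℕ} (ha : 3 ≤ a) : 9 * a ^ 6 ≤ 27 ^ a := by
  induction a, ha using Nat.le_induction with
  | base => norm_num
  | succ a ha ih =>
    have h2 : 3 ^ 6 * (a + 1) ^ 6 ≤ 4 ^ 6 * a ^ 6 := by
      rw [← mul_pow, ← mul_pow]; exact Nat.pow_le_pow_left (by omega) 6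
    rw [pow_succ 27]; omega

theorem ordCompl_semilinear_le {q p a : ℕ} (hq : q = 2 ∨ q = 3) (hp : p.Prime) :
    24 * (ordCompl[q] ((p ^ a - 1) * a)) ^ 3 ≤ (p ^ a) ^ 6 := by
  have hq' : q.Prime := by rcases hq with rfl | rfl <;> norm_num
  have hle : ordCompl[q] ((p ^ a - 1) * a) ≤ (p ^ a - 1) * a := Nat.ordCompl_le _ q
  have hp2 := hp.two_le
  have key : ∀ b, ordCompl[q] ((p ^ a - 1) * a) ≤ b → 24 * b ^ 3 ≤ (p ^ a) ^ 6 →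
      24 * (ordCompl[q] ((p ^ a - 1) * a)) ^ 3 ≤ (p ^ a) ^ 6 := fun b h1 h2 =>
    (Nat.mul_le_mul_left _ (Nat.pow_le_pow_left h1 _)).trans h2
  have hcrude : ∀ c, 24 * a ^ 3 ≤ c → c ≤ (p ^ a) ^ 3 →
      24 * (ordCompl[q] ((p ^ a - 1) * a)) ^ 3 ≤ (p ^ a) ^ 6 := fun c h1 h2 => by
    refine key (p ^ a * a) (hle.trans (by gcongr; omega)) ?_
    calc 24 * (p ^ a * a) ^ 3 = (p ^ a) ^ 3 * (24 * a ^ 3) := by ring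
      _ ≤ (p ^ a) ^ 3 * (p ^ a) ^ 3 := by gcongr; omega
      _ = _ := by ring
  rcases (show a = 0 ∨ a = 1 ∨ a = 2 ∨ a = 3 ∨ 4 ≤ a by omega) with rfl | rfl | rfl | rfl | ha
  · simp
  · refine key _ hle ?_
    rw [pow_one, mul_one]
    obtain ⟨w, rfl⟩ : ∃ w, p = w + 1 := ⟨p - 1, by omega⟩
    have h4 : 4 * w ≤ (w + 1) ^ 2 := by zify; nlinarith [sq_nonneg ((w : ℤ) - 1)]
    have := Nat.pow_le_pow_left h4 3
    rw [mul_pow, ← pow_mul] at this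
    norm_num at this ⊢
    omega
  · rcases (show p = 2 ∨ 3 ≤ p by omega) with rfl | h3
    · rcases hq with rfl | rfl
      · refine key 3 ?_ (by norm_num)
        simpa using ordCompl_pow_mul_le hq' 1 3
      · refine key 2 ?_ (by norm_num)
        simpa using ordCompl_pow_mul_le hq' 1 2
    · refine hcrude (9 ^ 3) (by norm_num) (Nat.pow_le_pow_left ?_ 3)
      nlinarith
  · rcases (show p = 2 ∨ 3 ≤ p by omega) with rfl | h3
    · exact key _ hle (by norm_num)
    · exact hcrude (27 ^ 3) (by norm_num) (Nat.pow_le_pow_left (Nat.pow_le_pow_left h3 3) 3)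
  · refine hcrude _ (cube_le_eight_pow ha) ?_
    rw [← pow_mul, mul_comm, pow_mul]
    exact Nat.pow_le_pow_left (Nat.pow_le_pow_left hp2 3) a

theorem ordCompl_semilinear_odd_le {p a : ℕ} (hp : p.Prime) (ha : a ≠ 0) (ho : Odd (p ^ a)) :
    576 * (ordCompl[2] ((p ^ a - 1) * a)) ^ 6 ≤ (p ^ a) ^ 9 := by
  obtain ⟨w, hw⟩ := ho
  have hp3 : 3 ≤ p := by
    have := hp.two_le
    rcases this.eq_or_lt with rfl | h
    · obtain ⟨b, rfl⟩ : ∃ b, a = b + 1 := ⟨a - 1, by omega⟩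
      rw [pow_succ] at hw; omega
    · exact h
  have hw2 : p ^ a - 1 = 2 * w := by omega
  have hle : ∀ b, ordCompl[2] a ≤ b → 9 * b ^ 6 ≤ (p ^ a) ^ 3 →
      576 * (ordCompl[2] ((p ^ a - 1) * a)) ^ 6 ≤ (p ^ a) ^ 9 := by
    intro b hb h9
    have h1 : ordCompl[2] ((p ^ a - 1) * a) ≤ w * b := by
      rw [Nat.ordCompl_mul, hw2]
      exact Nat.mul_le_mul (by simpa using ordCompl_pow_mul_le Nat.prime_two 1 w) hb
    calc 576 * (ordCompl[2] ((p ^ a - 1) * a)) ^ 6 ≤ 576 * (w * b) ^ 6 := by gcongr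
      _ = (2 * w) ^ 6 * (9 * b ^ 6) := by ring
      _ ≤ (p ^ a) ^ 6 * (p ^ a) ^ 3 := by gcongr; omega
      _ = _ := by ring
  have h3 : 3 ^ a ≤ p ^ a := Nat.pow_le_pow_left hp3 a
  by_cases ha3 : 3 ≤ a
  · refine hle a (Nat.ordCompl_le a 2) ((pow_six_le_pow ha3).trans ?_)
    rw [← pow_mul, mul_comm, pow_mul]
    exact Nat.pow_le_pow_left (Nat.pow_le_pow_left hp3 3) a
  · refine hle 1 ?_ ?_
    · have : a = 1 ∨ a = 2 := by omega
      rcases this with rfl | rfl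
      · simp
      · simpa using ordCompl_pow_mul_le Nat.prime_two 1 1
    · have : 3 ^ 1 ≤ p ^ a := (Nat.pow_le_pow_right (by norm_num) (by omega)).trans h3
      have := Nat.pow_le_pow_left this 3
      omega

/-- The numerical step for a group of semilinear maps of a field of order `p ^ a`. -/
theorem SharpOrderBound.of_semilinear {p a d v n : ℕ} (hp : p.Prime) (ha : a ≠ 0)
    (hd : d ≠ 0) (hv : v = (p ^ a) ^ d) (hv4 : v ≠ 4) (hn : n ∣ (p ^ a - 1) * a) :
    SharpOrderBound v n := by
  have h1 : 1 < p ^ a := Nat.one_lt_pow ha hp.one_lt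
  have h0 : (p ^ a - 1) * a ≠ 0 := Nat.mul_ne_zero (by omega) ha
  refine SharpOrderBound.of_dvd ?_ h0 hn
  have huv : p ^ a ≤ v := hv ▸ Nat.le_self_pow hd _
  refine ⟨⟨?_, ?_, fun ho => ?_⟩, fun h => absurd h hv4, fun h => ?_⟩
  · exact (ordCompl_semilinear_le (Or.inl rfl) hp).trans (Nat.pow_le_pow_left huv 6)
  · exact (ordCompl_semilinear_le (Or.inr rfl) hp).trans (Nat.pow_le_pow_left huv 6)
  · refine (ordCompl_semilinear_odd_le hp ha ?_).trans (Nat.pow_le_pow_left huv 9)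
    exact Odd.of_dvd_nat ho (hv ▸ dvd_pow_self _ hd)
  · have hp2 : p = 2 := by
      have : p ∣ 2 ^ 4 := by
        rw [show 2 ^ 4 = v by omega, hv]
        exact (dvd_pow_self p ha).trans (dvd_pow_self _ hd)
      exact (Nat.prime_dvd_prime_iff_eq hp Nat.prime_two).1 (hp.dvd_of_dvd_pow this)
    subst hp2
    have ha4 : a ≤ 4 := by
      by_contra! h5
      have : 2 ^ 5 ≤ 2 ^ a := Nat.pow_le_pow_right (by norm_num) h5
      omega
    have hle : ordCompl[3] ((2 ^ a - 1) * a) ≤ (2 ^ a - 1) * a := Nat.ordCompl_le _ 3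
    interval_cases a
    · omega
    · exact hle.trans (by norm_num)
    · exact hle.trans (by norm_num)
    · exact hle.trans (by norm_num)
    · have := ordCompl_pow_mul_le Nat.prime_three 1 20
      norm_num at this ⊢
      omega

theorem ordCompl_prod {ι : Type*} (q : ℕ) (s : Finset ι) (k : ι → ℕ) :
    ordCompl[q] (∏ i ∈ s, k i) = ∏ i ∈ s, ordCompl[q] (k i) := by
  classical
  induction s using Finset.induction_on with
  | empty => simp
  | insert a s ha ih => rw [Finset.prod_insert ha, Finset.prod_insert ha, Nat.ordCompl_mul, ih]

theorem prod_bound {ι : Type*} [Fintype ι] [Nonempty ι] {c s j l : ℕ} {w k : ι → ℕ}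
    (hs : s ^ j ≤ c ^ (Fintype.card ι - 1)) (h : ∀ i, c * k i ^ j ≤ w i ^ l) :
    c * (s * ∏ i, k i) ^ j ≤ (∏ i, w i) ^ l := by
  have hc : c * c ^ (Fintype.card ι - 1) = c ^ Fintype.card ι := by
    rw [← pow_succ']; congr 1
    have := Fintype.card_pos (α := ι)
    omega
  calc c * (s * ∏ i, k i) ^ j = c * s ^ j * (∏ i, k i) ^ j := by ring
    _ ≤ c * c ^ (Fintype.card ι - 1) * (∏ i, k i) ^ j := by gcongr
    _ = ∏ i, c * k i ^ j := by
      rw [hc, Finset.prod_mul_distrib, Finset.prod_const, Finset.card_univ, Finset.prod_pow]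
    _ ≤ ∏ i, w i ^ l := Finset.prod_le_prod' fun i _ => h i
    _ = _ := by rw [Finset.prod_pow]

/-- The numerical step for an imprimitive action: the constant `λ` in the bounds absorbs the order
`s ≤ λ ^ (n - 1)` of the group permuting the `n` summands. -/
theorem OrderBound.of_prod {ι : Type*} [Fintype ι] [Nonempty ι] {v n s : ℕ} {w k : ι → ℕ}
    (hs : s ^ 3 ≤ 24 ^ (Fintype.card ι - 1)) (h : ∀ i, OrderBound (w i) (k i))
    (hv : v = ∏ i, w i) (hn : n ∣ s * ∏ i, k i) (h0 : s * ∏ i, k i ≠ 0) : OrderBound v n := by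
  refine OrderBound.of_dvd ?_ h0 hn
  have hos : ∀ q, (ordCompl[q] s) ^ 3 ≤ 24 ^ (Fintype.card ι - 1) := fun q =>
    (Nat.pow_le_pow_left (Nat.ordCompl_le s q) 3).trans hs
  refine ⟨?_, ?_, fun ho => ?_⟩
  · rw [Nat.ordCompl_mul, ordCompl_prod, hv]
    exact prod_bound (hos 2) fun i => (h i).two
  · rw [Nat.ordCompl_mul, ordCompl_prod, hv]
    exact prod_bound (hos 3) fun i => (h i).three
  · rw [Nat.ordCompl_mul, ordCompl_prod, hv]
    refine prod_bound ?_ fun i => (h i).odd ?_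
    · have := Nat.pow_le_pow_left (hos 2) 2
      rw [← pow_mul, ← pow_mul, mul_comm (Fintype.card ι - 1), pow_mul 24] at this
      exact this
    · rw [hv] at ho
      exact Odd.of_dvd_nat ho (Finset.dvd_prod_of_mem w (Finset.mem_univ i))

/-- The numerical step for an imprimitive action with several summands of the same order. -/
theorem SharpOrderBound.of_prod {ι : Type*} [Fintype ι] [Nontrivial ι] {v n s w : ℕ} {k : ι → ℕ}
    (hs : s ^ 3 ≤ 24 ^ (Fintype.card ι - 1)) (h : ∀ i, SharpOrderBound w (k i))
    (hv : v = w ^ Fintype.card ι) (hv4 : v ≠ 4) (hn : n ∣ s * ∏ i, k i) (h0 : s * ∏ i, k i ≠ 0) :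
    SharpOrderBound v n := by
  refine ⟨OrderBound.of_prod hs (w := fun _ => w) (fun i => (h i).toOrderBound) (by simp [hv]) hn
    h0, fun h => absurd h hv4, fun h16 => ?_⟩
  refine (ordCompl_le_of_dvd 3 h0 hn).trans ?_
  rw [Nat.ordCompl_mul, ordCompl_prod]
  have hcard := Fintype.one_lt_card (α := ι)
  rw [h16] at hv
  have hos : ordCompl[3] s ≤ s := Nat.ordCompl_le s 3
  have hprod : ∀ b, (∀ i, ordCompl[3] (k i) ≤ b) →
      ordCompl[3] s * ∏ i, ordCompl[3] (k i) ≤ s * b ^ Fintype.card ι := fun b hb =>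
    Nat.mul_le_mul hos ((Finset.prod_le_prod' fun i _ => hb i).trans (by simp))
  have hw : w ≤ 4 := by
    by_contra! hw
    have : 5 ^ 2 ≤ w ^ Fintype.card ι :=
      (Nat.pow_le_pow_left hw 2).trans (Nat.pow_le_pow_right (by omega) hcard)
    omega
  generalize Fintype.card ι = c at *
  interval_cases w
  · rw [zero_pow (by omega)] at hv; omega
  · rw [one_pow] at hv; omega
  · have hc : c = 4 := by
      have : 2 ^ 4 = 2 ^ c := by omega
      exact (Nat.pow_right_injective le_rfl this).symm
    subst hc
    have h24 : s ≤ 24 := (Nat.pow_le_pow_iff_left (n := 3) (by norm_num)).1 hs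
    refine (hprod 1 fun i => le_of_cube_le (h i).three (by norm_num)).trans ?_
    omega
  · have h3 : 3 ∣ 16 := hv ▸ dvd_pow_self 3 (by omega)
    omega
  · have hc : c = 2 := by
      have : 4 ^ 2 = 4 ^ c := by omega
      exact (Nat.pow_right_injective (by norm_num) this).symm
    subst hc
    have h2 : s ≤ 2 := by
      by_contra! h3
      have : 3 ^ 3 ≤ s ^ 3 := Nat.pow_le_pow_left h3 3
      norm_num at hs
      omega
    refine (hprod 2 fun i => (h i).four rfl).trans ?_
    omega

/-! ### Abelian normal subgroups of solvable groups -/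

/-- The order of `G` when a subgroup `K` acts jointly faithfully through groups induced by larger
subgroups `H i`. -/
theorem card_dvd_index_mul_prod {G : Type*} [Group G] [Finite G] (K : Subgroup G) {ι : Type*}
    [Fintype ι] (H : ι → Subgroup G) (hK : ∀ i, K ≤ H i) {B : ι → Type*} [∀ i, Monoid (B i)]
    (ψ : ∀ i, H i →* B i)
    (hinj : ∀ g, g ∈ K → (∀ (i) (h : g ∈ H i), ψ i ⟨g, h⟩ = 1) → g = 1) :
    Nat.card G ∣ K.index * ∏ i, (ψ i).ker.index := by
  rw [← K.index_mul_card]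
  refine Nat.mul_dvd_mul_left _ ?_
  let f : K →* ∀ i, (H i ⧸ (ψ i).ker) :=
    MonoidHom.pi fun i => (QuotientGroup.mk' _).comp (Subgroup.inclusion (hK i))
  have hf : Function.Injective f := by
    rw [injective_iff_map_eq_one]
    intro g hg
    refine Subtype.ext (hinj g.1 g.2 fun i h => ?_)
    have := congrFun hg i
    exact (QuotientGroup.eq_one_iff (N := (ψ i).ker) _).1 this
  have := Subgroup.card_dvd_of_injective f hf
  rwa [Nat.card_pi] at this

/-- A nontrivial normal subgroup of a finite solvable group contains a minimal normal subgroup,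
and this is elementary abelian. -/
theorem exists_minimal_normal {G : Type*} [Group G] [Finite G] [Group.IsSolvable G]
    (C : Subgroup G) [C.Normal] (hC : C ≠ ⊥) :
    ∃ M ≤ C, M.Normal ∧ M ≠ ⊥ ∧ (∀ L ≤ M, L.Normal → L = ⊥ ∨ L = M) ∧
      (∀ x ∈ M, ∀ y ∈ M, x * y = y * x) ∧ ∃ r, r.Prime ∧ ∀ x ∈ M, x ^ r = 1 := by
  obtain ⟨M, ⟨hMC, hMn, hM0⟩, hmin⟩ :=
    WellFounded.has_min (wellFounded_lt (α := Subgroup G))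
      {M | M ≤ C ∧ M.Normal ∧ M ≠ ⊥} ⟨C, le_rfl, inferInstance, hC⟩
  have hmin' : ∀ L ≤ M, L.Normal → L = ⊥ ∨ L = M := fun L hL hn => by
    by_contra! h
    exact hmin L ⟨hL.trans hMC, hn, h.1⟩ (lt_of_le_of_ne hL h.2)
  have hab : ∀ x ∈ M, ∀ y ∈ M, x * y = y * x := by
    have hlt : ⁅M, M⁆ < M := Group.IsSolvable.commutator_lt_of_ne_bot hM0
    have : ⁅M, M⁆ = ⊥ := (hmin' _ hlt.le inferInstance).resolve_right hlt.ne
    intro x hx y hy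
    have := this ▸ Subgroup.commutator_mem_commutator hx hy
    rw [Subgroup.mem_bot] at this
    exact commutatorElement_eq_one_iff_mul_comm.1 this
  refine ⟨M, hMC, hMn, hM0, hmin', hab, (Nat.card M).minFac, ?_, ?_⟩
  · exact Nat.minFac_prime fun h => hM0 (Subgroup.card_eq_one.1 h)
  have hp : (Nat.card M).minFac.Prime :=
    Nat.minFac_prime fun h => hM0 (Subgroup.card_eq_one.1 h)
  set r := (Nat.card M).minFac with hr
  let L : Subgroup G :=
    { carrier := {x | x ∈ M ∧ x ^ r = 1}
      one_mem' := ⟨M.one_mem, one_pow r⟩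
      mul_mem' := fun {a b} ha hb =>
        ⟨M.mul_mem ha.1 hb.1, by
          rw [(show Commute a b from hab a ha.1 b hb.1).mul_pow, ha.2, hb.2, one_mul]⟩
      inv_mem' := fun {a} ha => ⟨M.inv_mem ha.1, by rw [inv_pow, ha.2, inv_one]⟩ }
  have hLn : L.Normal := ⟨fun x hx g => ⟨hMn.conj_mem x hx.1 g, by
    rw [conj_pow, hx.2, mul_one, mul_inv_cancel]⟩⟩
  have hL : L = M := by
    refine (hmin' L (fun x hx => hx.1) hLn).resolve_left fun h => ?_
    have := Fact.mk hp
    obtain ⟨x, hx⟩ := exists_prime_orderOf_dvd_card' (G := M) r (Nat.minFac_dvd _)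
    have hxL : (x : G) ∈ L := ⟨x.2, by
      have := pow_orderOf_eq_one x
      rw [hx] at this
      exact_mod_cast congrArg Subtype.val this⟩
    rw [h, Subgroup.mem_bot] at hxL
    have : x = 1 := Subtype.ext hxL
    rw [this, orderOf_one] at hx
    exact hp.one_lt.ne hx
  intro x hx
  rw [← hL] at hx
  exact hx.2

/-! ### The order of a solvable permutation group -/

theorem card_orbit_mul_card_stabilizer (G : Type*) [Group G] {X : Type*} [MulAction G X] (x : X) :
    Nat.card (MulAction.orbit G x) * Nat.card (MulAction.stabilizer G x) = Nat.card G := by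
  rw [← Nat.card_prod]
  exact Nat.card_congr (MulAction.orbitProdStabilizerEquivGroup G x)

/-- Each new generator of a finite group `B` lies outside the subgroup generated so far, and that
subgroup at least doubles in every step. -/
theorem card_le_prod_of_fixes {B : Type*} [Group B] [Finite B] (m : ℕ) :
    ∀ (K : Subgroup B) (A : Subgroup (MulAut B)) (j : ℕ), Nat.card B - Nat.card K ≤ m →
      (∀ f ∈ A, ∀ x ∈ K, f x = x) → 2 ^ j ≤ Nat.card K →
      Nat.card A ≤ ∏ i ∈ Finset.Ico j (Nat.log 2 (Nat.card B)), (Nat.card B - 2 ^ i) := by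
  induction m with
  | zero =>
    intro K A j hm hA hj
    have hK : K = ⊤ := by
      refine Subgroup.eq_top_of_card_eq K (le_antisymm (Subgroup.card_le_card_group K) ?_)
      omega
    have hA1 : A = ⊥ := by
      rw [eq_bot_iff]
      intro f hf
      rw [Subgroup.mem_bot]
      ext x
      exact hA f hf x (hK ▸ Subgroup.mem_top x)
    rw [hA1, Subgroup.card_bot]
    refine Finset.one_le_prod' fun i hi => ?_
    have h1 := (Finset.mem_Ico.1 hi).2
    have h2 : 2 ^ i < 2 ^ Nat.log 2 (Nat.card B) := Nat.pow_lt_pow_right (by norm_num) h1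
    have h3 : 2 ^ Nat.log 2 (Nat.card B) ≤ Nat.card B := Nat.pow_log_le_self 2 Nat.card_pos.ne'
    omega
  | succ m ih =>
    intro K A j hm hA hj
    by_cases hK : K = ⊤
    · exact ih K A j (by rw [hK, Subgroup.card_top]; omega) hA hj
    obtain ⟨x, hx⟩ : ∃ x, x ∉ K := by
      by_contra! h
      exact hK ((Subgroup.eq_top_iff' K).2 h)
    set K' := K ⊔ Subgroup.zpowers x with hK'
    have hxK' : x ∈ K' := (le_sup_right : _ ≤ K') (Subgroup.mem_zpowers x)
    have hKK' : K ≤ K' := le_sup_left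
    have hcard : 2 * Nat.card K ≤ Nat.card K' := by
      obtain ⟨c, hc⟩ := Subgroup.card_dvd_of_le hKK'
      have hne : Nat.card K ≠ Nat.card K' := fun h => by
        have := Subgroup.eq_of_le_of_card_ge hKK' h.ge
        exact hx (this ▸ hxK')
      rcases c with _ | _ | c
      · have := Nat.card_pos (α := K'); omega
      · omega
      · rw [hc]; nlinarith [Nat.card_pos (α := K)]
    have hKB := Subgroup.card_le_card_group K'
    have hj' : 2 ^ (j + 1) ≤ Nat.card K' := by rw [pow_succ]; omega
    have hjlog : j < Nat.log 2 (Nat.card B) := Nat.le_log_of_pow_le (by norm_num) (hj'.trans hKB)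
    have horb := card_orbit_mul_card_stabilizer A x
    rw [← Finset.prod_Ico_consecutive _ (Nat.le_succ j) hjlog]
    have hstab : Nat.card (MulAction.stabilizer A x) ≤
        ∏ i ∈ Finset.Ico (j + 1) (Nat.log 2 (Nat.card B)), (Nat.card B - 2 ^ i) := by
      have hmap : Nat.card ((MulAction.stabilizer A x).map A.subtype) =
          Nat.card (MulAction.stabilizer A x) :=
        Subgroup.card_map_of_injective A.subtype_injective
      rw [← hmap]
      refine ih K' _ (j + 1) ?_ ?_ hj'
      · have := Nat.card_pos (α := K); omega
      · rintro f ⟨⟨f', hf'⟩, hfx, rfl⟩ y hy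
        have hle : K' ≤ (MonoidHom.eqLocus (f' : B →* B) (MonoidHom.id B)) := by
          refine sup_le (fun z hz => hA f' hf' z hz) ?_
          rw [Subgroup.zpowers_le]
          exact hfx
        exact hle hy
    have horbit : Nat.card (MulAction.orbit A x) ≤ Nat.card B - 2 ^ j := by
      have hsub : MulAction.orbit A x ⊆ (K : Set B)ᶜ := by
        rintro _ ⟨⟨f, hf⟩, rfl⟩ hmem
        have h1 : f (f x) = f x := hA f hf _ hmem
        have h2 : f x = x := f.injective h1
        exact hx (h2 ▸ hmem)
      have h1 := Set.ncard_le_ncard hsub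
      have h2 := Set.ncard_add_ncard_compl (K : Set B)
      rw [← Nat.card_coe_set_eq] at h1 h2
      have h3 : Nat.card (K : Set B) = Nat.card K := rfl
      omega
    rw [← horb]
    simp only [Nat.Ico_succ_singleton, Finset.prod_singleton]
    exact Nat.mul_le_mul horbit hstab

/-- The `i`-th generator, counted from `0`, has at most `|B| - 2 ^ i` possible images. -/
theorem card_mulAut_le (B : Type*) [Group B] [Finite B] :
    Nat.card (MulAut B) ≤ ∏ i ∈ Finset.range (Nat.log 2 (Nat.card B)), (Nat.card B - 2 ^ i) := by
  have := card_le_prod_of_fixes (B := B) _ ⊥ ⊤ 0 le_rfl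
    (fun f _ x hx => by rw [Subgroup.mem_bot.1 hx, map_one]) (by simp)
  rwa [Subgroup.card_top, ← Finset.range_eq_Ico] at this

theorem three_mul_sq_le {L : ℕ} (hL : 5 ≤ L) : 3 * (L + 1) ^ 2 + 4 ≤ 4 * 2 ^ L := by
  induction L, hL using Nat.le_induction with
  | base => norm_num
  | succ L hL ih => rw [pow_succ 2 L]; nlinarith

theorem mul_prod_pow_three_le {n : ℕ} (hn : 2 ≤ n) :
    (n * ∏ i ∈ Finset.range (Nat.log 2 n), (n - 2 ^ i)) ^ 3 ≤ 24 ^ (n - 1) := by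
  have h1 : 2 ^ Nat.log 2 n ≤ n := Nat.pow_log_le_self 2 (by omega)
  have h2 : n < 2 ^ (Nat.log 2 n + 1) := Nat.lt_pow_succ_log_self (by norm_num) n
  generalize Nat.log 2 n = L at *
  by_cases hL : 5 ≤ L
  · have hprod : ∏ i ∈ Finset.range L, (n - 2 ^ i) ≤ n ^ L :=
      (Finset.prod_le_prod' fun i _ => Nat.sub_le n (2 ^ i)).trans (by simp)
    calc (n * ∏ i ∈ Finset.range L, (n - 2 ^ i)) ^ 3 ≤ (n * n ^ L) ^ 3 := by gcongr
      _ = n ^ (3 * (L + 1)) := by rw [← pow_succ', ← pow_mul, mul_comm]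
      _ ≤ (2 ^ (L + 1)) ^ (3 * (L + 1)) := Nat.pow_le_pow_left h2.le _
      _ = 2 ^ (3 * (L + 1) ^ 2) := by rw [← pow_mul]; congr 1; ring
      _ ≤ 2 ^ (4 * (n - 1)) := Nat.pow_le_pow_right (by norm_num) (by
          have := three_mul_sq_le hL; omega)
      _ = 16 ^ (n - 1) := by rw [pow_mul]; norm_num
      _ ≤ 24 ^ (n - 1) := Nat.pow_le_pow_left (by norm_num) _
  · interval_cases L
    · omega
    all_goals
      simp only [Finset.prod_range_succ, Finset.prod_range_zero]
      norm_num at h1 h2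
      interval_cases n <;> norm_num

section Permutations

open Equiv

variable {Ω : Type*} {S : Subgroup (Perm Ω)}

/-- The action of a permutation group on the classes of an invariant equivalence relation. -/
def quotientPerm (S : Subgroup (Perm Ω)) (R : Setoid Ω)
    (hR : ∀ s ∈ S, ∀ x y, R x y ↔ R (s x) (s y)) : S →* Perm (Quotient R) where
  toFun s := Quotient.congr (s : Perm Ω) (hR s.1 s.2)
  map_one' := by ext ⟨x⟩; rfl
  map_mul' a b := by ext ⟨x⟩; rfl

theorem mk_apply_of_mem_ker {R : Setoid Ω} {hR : ∀ s ∈ S, ∀ x y, R x y ↔ R (s x) (s y)} {s : S}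
    (hs : s ∈ (quotientPerm S R hR).ker) (x : Ω) :
    (Quotient.mk R ((s : Perm Ω) x)) = Quotient.mk R x :=
  congrFun (congrArg DFunLike.coe hs) (Quotient.mk R x)

/-- The action on one class of the permutations that fix every class. -/
def classPerm (S : Subgroup (Perm Ω)) (R : Setoid Ω)
    (hR : ∀ s ∈ S, ∀ x y, R x y ↔ R (s x) (s y)) (q : Quotient R) :
    (quotientPerm S R hR).ker →* Perm {x // Quotient.mk R x = q} where
  toFun s := (s.1 : Perm Ω).subtypePerm fun x => by rw [mk_apply_of_mem_ker s.2]
  map_one' := rfl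
  map_mul' _ _ := rfl

theorem sum_card_classes [Finite Ω] (R : Setoid Ω) [Fintype (Quotient R)] :
    ∑ q : Quotient R, Nat.card {x // Quotient.mk R x = q} = Nat.card Ω := by
  rw [← Nat.card_sigma]
  exact Nat.card_congr (Equiv.sigmaFiberEquiv (Quotient.mk R))

/-- A solvable permutation group with a transitive abelian normal subgroup `N`: the subgroup `N` is
regular, and a point stabilizer acts faithfully on `N` by conjugation. -/
theorem card_le_of_transitive [Finite Ω] (N : Subgroup S) [N.Normal]
    (hN : ∀ x ∈ N, ∀ y ∈ N, x * y = y * x) (ω : Ω) (htr : ∀ x, ∃ g ∈ N, (g : Perm Ω) ω = x) :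
    Nat.card S ≤ Nat.card Ω * Nat.card (MulAut N) ∧ Nat.card N = Nat.card Ω := by
  have hfix : ∀ g : S, (∀ m ∈ N, g * m = m * g) → (g : Perm Ω) ω = ω → g = 1 := by
    intro g hg hgω
    refine Subtype.ext (Equiv.ext fun x => ?_)
    obtain ⟨m, hm, rfl⟩ := htr x
    have := congrArg (fun s : S => (s : Perm Ω) ω) (hg m hm)
    simp only [Subgroup.coe_mul, Perm.mul_apply, hgω] at this
    exact this
  constructor
  · rw [← card_orbit_mul_card_stabilizer S ω]
    refine Nat.mul_le_mul (Nat.card_le_card_of_injective _ Subtype.val_injective) ?_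
    let f : MulAction.stabilizer S ω →* MulAut N :=
      MulAut.conjNormal.comp (MulAction.stabilizer S ω).subtype
    refine Nat.card_le_card_of_injective f ?_
    rw [injective_iff_map_eq_one]
    intro g hg
    refine Subtype.ext (hfix g.1 (fun m hm => ?_) g.2)
    have h1 : f g ⟨m, hm⟩ = ⟨m, hm⟩ := by rw [hg]; rfl
    have h2 := congrArg Subtype.val h1
    have h3 : (g : S) * m * (g : S)⁻¹ = m := h2
    exact mul_inv_eq_iff_eq_mul.1 h3
  · refine Nat.card_eq_of_bijective (fun g : N => ((g : S) : Perm Ω) ω) ⟨?_, ?_⟩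
    · intro a b hab
      have h1 : (b⁻¹ * a : N).1 = 1 := by
        refine hfix _ (fun m hm => hN _ (b⁻¹ * a).2 m hm) ?_
        change (((b : S) : Perm Ω)⁻¹ * ((a : S) : Perm Ω)) ω = ω
        rw [Perm.mul_apply, show ((a : S) : Perm Ω) ω = ((b : S) : Perm Ω) ω from hab]
        simp
      have h2 : (b⁻¹ * a : N) = 1 := Subtype.ext h1
      exact (inv_mul_eq_one.1 h2).symm
    · intro x
      obtain ⟨g, hg, h⟩ := htr x
      exact ⟨⟨g, hg⟩, h⟩

/-- A solvable permutation group of degree `n` has order at most `λ ^ (n - 1)`, where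
`λ ^ 3 = 24`. -/
theorem card_solvable_perm_pow_three_le (n : ℕ) : ∀ (Ω : Type*) [Finite Ω] [Nonempty Ω],
    Nat.card Ω = n → ∀ (S : Subgroup (Perm Ω)) [Group.IsSolvable S],
      Nat.card S ^ 3 ≤ 24 ^ (n - 1) := by
  induction n using Nat.strong_induction_on with
  | _ n ih =>
  intro Ω _ _ hΩ S _
  classical
  by_cases hS : (⊤ : Subgroup S) = ⊥
  · have h1 : Nat.card S = 1 := by rw [← Subgroup.card_top, hS, Subgroup.card_bot]
    rw [h1, one_pow]
    exact Nat.one_le_pow _ _ (by norm_num)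
  obtain ⟨N, -, hNn, hN0, -, hNc, -⟩ := exists_minimal_normal (⊤ : Subgroup S) hS
  let R : Setoid Ω := MulAction.orbitRel N Ω
  have hRiff : ∀ x y, R x y ↔ ∃ g ∈ N, (g : Perm Ω) y = x := by
    intro x y
    constructor
    · rintro ⟨g, hg⟩; exact ⟨g.1, g.2, hg⟩
    · rintro ⟨g, hg, h⟩; exact ⟨⟨g, hg⟩, h⟩
  have hR : ∀ s ∈ S, ∀ x y, R x y ↔ R (s x) (s y) := by
    have hmp : ∀ s ∈ S, ∀ x y, R x y → R (s x) (s y) := by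
      intro s hs x y h
      obtain ⟨g, hg, rfl⟩ := (hRiff x y).1 h
      refine (hRiff _ _).2 ⟨_, hNn.conj_mem g hg ⟨s, hs⟩, ?_⟩
      simp
    intro s hs x y
    refine ⟨hmp s hs x y, fun h => ?_⟩
    simpa using hmp s⁻¹ (S.inv_mem hs) _ _ h
  have := Fintype.ofFinite (Quotient R)
  obtain ⟨ω⟩ := ‹Nonempty Ω›
  have hmoves : ∃ x y : Ω, x ≠ y ∧ R x y := by
    obtain ⟨⟨g, hg⟩, hg1⟩ := Subgroup.ne_bot_iff_exists_ne_one.1 hN0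
    replace hg1 : g ≠ 1 := fun h => hg1 (Subtype.ext h)
    obtain ⟨y, hy⟩ : ∃ y, (g : Perm Ω) y ≠ y := by
      by_contra! h
      exact hg1 (Subtype.ext (Equiv.ext h))
    exact ⟨_, y, hy, (hRiff _ _).2 ⟨g, hg, rfl⟩⟩
  obtain ⟨x₀, y₀, hne, hxy⟩ := hmoves
  by_cases htr : ∀ x y, R x y
  · obtain ⟨h1, h2⟩ := card_le_of_transitive N hNc ω fun x => (hRiff x ω).1 (htr x ω)
    have hn2 : 2 ≤ n := by
      rw [← hΩ]
      have : Nontrivial Ω := ⟨x₀, y₀, hne⟩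
      exact Finite.one_lt_card
    have h3 := card_mulAut_le N
    rw [h2, hΩ] at h3
    rw [hΩ] at h1
    exact (Nat.pow_le_pow_left (h1.trans (Nat.mul_le_mul_left n h3)) 3).trans
      (mul_prod_pow_three_le hn2)
  · push Not at htr
    obtain ⟨x₁, y₁, hxy₁⟩ := htr
    have hsum := sum_card_classes R
    rw [hΩ] at hsum
    set f : Quotient R → ℕ := fun q => Nat.card {x // Quotient.mk R x = q} with hf
    have hnonempty : ∀ q : Quotient R, Nonempty {x // Quotient.mk R x = q} := fun q => by
      obtain ⟨x, hx⟩ := Quotient.exists_rep q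
      exact ⟨⟨x, hx⟩⟩
    have hfpos : ∀ q, 1 ≤ f q := fun q => Nat.card_pos
    have hQn : Nat.card (Quotient R) < n := by
      rw [← hΩ]
      refine lt_of_le_of_ne (Nat.card_le_card_of_surjective _ Quotient.mk_surjective) fun h => ?_
      have hbij := (Nat.bijective_iff_surjective_and_card (Quotient.mk R)).2
        ⟨Quotient.mk_surjective, h.symm⟩
      exact hne (hbij.1 (Quotient.sound hxy))
    have hfn : ∀ q, f q < n := by
      intro q
      obtain ⟨q', hq'⟩ : ∃ q', q' ≠ q := by
        by_contra! h
        exact hxy₁ (Quotient.exact ((h ⟦x₁⟧).trans (h ⟦y₁⟧).symm))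
      have h1 : ∑ i ∈ {q, q'}, f i ≤ ∑ i, f i :=
        Finset.sum_le_sum_of_subset (Finset.subset_univ {q, q'})
      rw [Finset.sum_pair hq'.symm, hsum] at h1
      have := hfpos q'
      omega
    have : Nonempty (Quotient R) := ⟨⟦ω⟧⟩
    set φ := quotientPerm S R hR with hφ
    have : Group.IsSolvable φ.range := Group.isSolvable_of_surjective φ.rangeRestrict_surjective
    have (q : Quotient R) : Group.IsSolvable (classPerm S R hR q).range :=
      Group.isSolvable_of_surjective (classPerm S R hR q).rangeRestrict_surjective
    have hdvd := card_dvd_index_mul_prod φ.ker (fun _ : Quotient R => φ.ker) (fun _ => le_rfl)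
      (classPerm S R hR) (by
        intro g hg h
        refine Subtype.ext (Equiv.ext fun x => ?_)
        have := congrArg DFunLike.coe (h ⟦x⟧ hg)
        exact congrArg Subtype.val (congrFun this ⟨x, rfl⟩))
    have hle := Nat.le_of_dvd (Nat.pos_of_ne_zero (mul_ne_zero Subgroup.index_ne_zero_of_finite
      (Finset.prod_ne_zero_iff.2 fun i _ => Subgroup.index_ne_zero_of_finite))) hdvd
    refine (Nat.pow_le_pow_left hle 3).trans ?_
    rw [mul_pow, ← Finset.prod_pow]
    have hφb : φ.ker.index ^ 3 ≤ 24 ^ (Nat.card (Quotient R) - 1) := by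
      rw [Subgroup.index_ker]
      exact ih _ hQn (Quotient R) rfl φ.range
    have hψb : ∀ q, (classPerm S R hR q).ker.index ^ 3 ≤ 24 ^ (f q - 1) := fun q => by
      rw [Subgroup.index_ker]
      exact ih _ (hfn q) _ rfl (classPerm S R hR q).range
    refine (Nat.mul_le_mul hφb (Finset.prod_le_prod' fun q _ => hψb q)).trans ?_
    rw [Finset.prod_pow_eq_pow_sum, ← pow_add]
    refine Nat.pow_le_pow_right (by norm_num) ?_
    have h1 : ∑ q, (f q - 1) + Nat.card (Quotient R) = n := by
      rw [Nat.card_eq_fintype_card, ← Finset.card_univ, Finset.card_eq_sum_ones,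
        ← Finset.sum_add_distrib, ← hsum]
      exact Finset.sum_congr rfl fun q _ => Nat.sub_add_cancel (hfpos q)
    have h2 : 0 < Nat.card (Quotient R) := Nat.card_pos
    omega

end Permutations

theorem index_ker_perm_pow_three_le {G : Type*} [Group G] [Group.IsSolvable G] {Ω : Type*}
    [Finite Ω] [Nonempty Ω] (φ : G →* Equiv.Perm Ω) :
    φ.ker.index ^ 3 ≤ 24 ^ (Nat.card Ω - 1) := by
  rw [Subgroup.index_ker]
  have : Group.IsSolvable φ.range := Group.isSolvable_of_surjective φ.rangeRestrict_surjective
  exact card_solvable_perm_pow_three_le _ Ω rfl φ.range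

/-! ### Irreducible actions and their restrictions to normal subgroups -/

/-- The action `ρ` of `G` on the abelian group `V` has no invariant subgroups besides the trivial
ones. The zero group is allowed. -/
def IrrAction {G V : Type*} [Group G] [AddCommGroup V] (ρ : G →* AddMonoid.End V) : Prop :=
  ∀ W : AddSubgroup V, (∀ g, ∀ w ∈ W, ρ g w ∈ W) → W = ⊥ ∨ W = ⊤

/-- The order bound holds for all irreducible actions of solvable groups on nontrivial groups of
order less than `n`. -/
def BoundBelow.{u} (n : ℕ) : Prop :=
  ∀ (W : Type u) [AddCommGroup W] [Finite W] [Nontrivial W], Nat.card W < n →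
    ∀ (H : Type u) [Group H] [Finite H] [Group.IsSolvable H] (τ : H →* AddMonoid.End W),
      IrrAction τ → SharpOrderBound (Nat.card W) τ.ker.index

section Clifford

variable {G V : Type*} [Group G] [AddCommGroup V] (ρ : G →* AddMonoid.End V)

/-- The ring of endomorphisms of `V` generated by the action of `N`. The `N`-invariant subgroups
of `V` are its submodules over this ring. -/
def actionRing (N : Subgroup G) : Subring (AddMonoid.End V) :=
  Subring.closure (ρ '' N)

variable {ρ}

theorem map_mem_actionRing {N : Subgroup G} {g : G} (hg : g ∈ N) : ρ g ∈ actionRing ρ N :=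
  Subring.subset_closure ⟨g, hg, rfl⟩

theorem actionRing_mono {N N' : Subgroup G} (h : N ≤ N') : actionRing ρ N ≤ actionRing ρ N' :=
  Subring.closure_mono (Set.image_mono h)

theorem apply_mem_of_mem {N : Subgroup G} (W : Submodule (actionRing ρ N) V) {g : G} (hg : g ∈ N)
    {w : V} (hw : w ∈ W) : ρ g w ∈ W :=
  W.smul_mem (⟨ρ g, map_mem_actionRing hg⟩ : actionRing ρ N) hw

@[simp] theorem map_apply_map_inv_apply (g : G) (v : V) : ρ g (ρ g⁻¹ v) = v := by
  have : ρ g * ρ g⁻¹ = 1 := by rw [← map_mul, mul_inv_cancel, map_one]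
  exact congrArg (fun f : AddMonoid.End V => f v) this

@[simp] theorem map_inv_apply_map_apply (g : G) (v : V) : ρ g⁻¹ (ρ g v) = v := by
  have : ρ g⁻¹ * ρ g = 1 := by rw [← map_mul, inv_mul_cancel, map_one]
  exact congrArg (fun f : AddMonoid.End V => f v) this

/-- An invariant subgroup as a submodule over the ring generated by the action. -/
def invariantSubmodule {N : Subgroup G} (W : AddSubgroup V)
    (h : ∀ g ∈ N, ∀ w ∈ W, ρ g w ∈ W) : Submodule (actionRing ρ N) V where
  __ := W
  smul_mem' := by
    rintro ⟨r, hr⟩ w hw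
    change r w ∈ W
    replace hw : w ∈ W := hw
    suffices ∀ w ∈ W, r w ∈ W from this w hw
    clear hw w
    induction hr using Subring.closure_induction with
    | mem x hx => obtain ⟨g, hg, rfl⟩ := hx; exact h g hg
    | zero => exact fun _ _ => W.zero_mem
    | one => exact fun _ hw => hw
    | add x y _ _ hx hy => exact fun w hw => W.add_mem (hx w hw) (hy w hw)
    | neg x _ hx => exact fun w hw => W.neg_mem (hx w hw)
    | mul x y _ _ hx hy => exact fun w hw => hx _ (hy w hw)

theorem conj_mem_actionRing {N : Subgroup G} [hN : N.Normal] (g : G) {r : AddMonoid.End V}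
    (hr : r ∈ actionRing ρ N) : ρ g * r * ρ g⁻¹ ∈ actionRing ρ N := by
  have hinv : ρ g⁻¹ * ρ g = 1 := by rw [← map_mul, inv_mul_cancel, map_one]
  induction hr using Subring.closure_induction with
  | mem x hx =>
    obtain ⟨n, hn, rfl⟩ := hx
    rw [← map_mul, ← map_mul]
    exact map_mem_actionRing (hN.conj_mem n hn g)
  | zero => rw [mul_zero, zero_mul]; exact Subring.zero_mem _
  | one =>
    rw [mul_one, ← map_mul, mul_inv_cancel, map_one]
    exact Subring.one_mem _
  | add x y _ _ hx hy => rw [mul_add, add_mul]; exact Subring.add_mem _ hx hy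
  | neg x _ hx => rw [mul_neg, neg_mul]; exact Subring.neg_mem _ hx
  | mul x y _ _ hx hy =>
    have : ρ g * (x * y) * ρ g⁻¹ = (ρ g * x * ρ g⁻¹) * (ρ g * y * ρ g⁻¹) := by
      simp only [mul_assoc]
      rw [← mul_assoc (ρ g⁻¹) (ρ g), hinv, one_mul]
    rw [this]
    exact Subring.mul_mem _ hx hy

theorem map_apply_eq_conj_apply (g : G) (r : AddMonoid.End V) (v : V) :
    ρ g (r v) = (ρ g * r * ρ g⁻¹) (ρ g v) := by
  simp [AddMonoid.End.coe_mul, Function.comp_apply]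

/-- The image of a submodule for a normal subgroup under an element `g` of the group, written as
the preimage under `g⁻¹`. -/
def translateSubmodule {N : Subgroup G} [N.Normal] (g : G) (W : Submodule (actionRing ρ N) V) :
    Submodule (actionRing ρ N) V where
  carrier := {v | ρ g⁻¹ v ∈ W}
  add_mem' {a b} ha hb := by
    change ρ g⁻¹ (a + b) ∈ W
    rw [map_add]; exact W.add_mem ha hb
  zero_mem' := by change ρ g⁻¹ 0 ∈ W; rw [map_zero]; exact W.zero_mem
  smul_mem' := by
    rintro ⟨r, hr⟩ v hv
    change ρ g⁻¹ (r v) ∈ W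
    rw [map_apply_eq_conj_apply]
    exact W.smul_mem (⟨_, conj_mem_actionRing g⁻¹ hr⟩ : actionRing ρ N) hv

theorem mem_translateSubmodule {N : Subgroup G} [N.Normal] {g : G}
    {W : Submodule (actionRing ρ N) V} {v : V} :
    v ∈ translateSubmodule g W ↔ ρ g⁻¹ v ∈ W := Iff.rfl

theorem translateSubmodule_mul {N : Subgroup G} [N.Normal] (g h : G)
    (W : Submodule (actionRing ρ N) V) :
    translateSubmodule (g * h) W = translateSubmodule g (translateSubmodule h W) := by
  ext v
  simp only [mem_translateSubmodule]
  rw [mul_inv_rev, map_mul, AddMonoid.End.coe_mul, Function.comp_apply]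

theorem translateSubmodule_one {N : Subgroup G} [N.Normal] (W : Submodule (actionRing ρ N) V) :
    translateSubmodule 1 W = W := by
  ext v
  rw [mem_translateSubmodule, inv_one, map_one, AddMonoid.End.one_apply]

/-- Translation by a group element as an automorphism of the lattice of submodules. -/
def translateIso {N : Subgroup G} [N.Normal] (g : G) :
    Submodule (actionRing ρ N) V ≃o Submodule (actionRing ρ N) V where
  toFun := translateSubmodule g
  invFun := translateSubmodule g⁻¹
  left_inv W := by rw [← translateSubmodule_mul, inv_mul_cancel, translateSubmodule_one]
  right_inv W := by rw [← translateSubmodule_mul, mul_inv_cancel, translateSubmodule_one]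
  map_rel_iff' {W W'} := by
    refine ⟨fun h v hv => ?_, fun h v hv => h hv⟩
    have : ρ g v ∈ translateSubmodule g W := by
      rw [mem_translateSubmodule, map_inv_apply_map_apply]; exact hv
    have := h this
    rwa [Equiv.coe_fn_mk, mem_translateSubmodule, map_inv_apply_map_apply] at this

theorem mem_translateIso {N : Subgroup G} [N.Normal] {g : G} {W : Submodule (actionRing ρ N) V}
    {v : V} : v ∈ translateIso g W ↔ ρ g⁻¹ v ∈ W := Iff.rfl

theorem apply_mem_translateIso {N : Subgroup G} [N.Normal] {g : G} {W : Submodule (actionRing ρ N) V}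
    {v : V} (hv : v ∈ W) : ρ g v ∈ translateIso g W := by
  rwa [mem_translateIso, map_inv_apply_map_apply]

theorem translateIso_mul {N : Subgroup G} [N.Normal] (g h : G) (W : Submodule (actionRing ρ N) V) :
    translateIso (g * h) W = translateIso g (translateIso h W) := translateSubmodule_mul g h W

theorem translateIso_one {N : Subgroup G} [N.Normal] (W : Submodule (actionRing ρ N) V) :
    translateIso 1 W = W := translateSubmodule_one W

/-- For an irreducible action, a submodule fixed by all translations is trivial. -/
theorem IrrAction.eq_bot_or_top (hirr : IrrAction ρ) {N : Subgroup G} [N.Normal]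
    (W : Submodule (actionRing ρ N) V) (h : ∀ g, translateIso g W = W) : W = ⊥ ∨ W = ⊤ := by
  rcases hirr W.toAddSubgroup (fun g w hw => by
    have := apply_mem_translateIso (g := g) hw
    rwa [h g] at this) with h | h
  · left
    rw [Submodule.eq_bot_iff]
    intro x hx
    have : x ∈ W.toAddSubgroup := hx
    rwa [h, AddSubgroup.mem_bot] at this
  · right
    rw [Submodule.eq_top_iff']
    intro x
    have : x ∈ W.toAddSubgroup := h ▸ AddSubgroup.mem_top x
    exact this

/-- The socle is invariant under translation, hence everything. -/
theorem IrrAction.isSemisimpleModule [Finite V] [Nontrivial V] (hirr : IrrAction ρ)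
    (N : Subgroup G) [N.Normal] : IsSemisimpleModule (actionRing ρ N) V := by
  rw [isSemisimpleModule_iff]
  refine complementedLattice_of_sSup_atoms_eq_top ?_
  refine (hirr.eq_bot_or_top (sSup {a | IsAtom a}) fun g => ?_).resolve_left fun h => ?_
  · rw [(translateIso g).map_sSup]
    refine le_antisymm (iSup₂_le fun a ha => le_sSup ?_) (sSup_le fun a ha => ?_)
    · exact ((translateIso g).isAtom_iff a).2 ha
    · refine le_trans (le_of_eq ((translateIso g).apply_symm_apply a).symm)
        (le_iSup₂_of_le ((translateIso g).symm a) ?_ le_rfl)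
      exact ((translateIso g).symm.isAtom_iff a).2 ha
  · obtain ⟨a, ha⟩ := IsAtomic.exists_atom (Submodule (actionRing ρ N) V)
    exact ha.1 (le_bot_iff.1 (h ▸ le_sSup ha))

theorem isFullyInvariant_translate {N : Subgroup G} [N.Normal] (g : G)
    {W : Submodule (actionRing ρ N) V} (hW : W.IsFullyInvariant) :
    (translateIso g W).IsFullyInvariant := by
  intro f v hv
  let f' : Module.End (actionRing ρ N) V :=
    { toFun := fun x => ρ g⁻¹ (f (ρ g x))
      map_add' := fun x y => by simp only [map_add]
      map_smul' := by
        rintro ⟨r, hr⟩ x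
        change ρ g⁻¹ (f (ρ g (r x))) = r (ρ g⁻¹ (f (ρ g x)))
        rw [map_apply_eq_conj_apply]
        have h1 := f.map_smul (⟨_, conj_mem_actionRing g hr⟩ : actionRing ρ N) (ρ g x)
        change f ((ρ g * r * ρ g⁻¹) (ρ g x)) = (ρ g * r * ρ g⁻¹) (f (ρ g x)) at h1
        rw [h1]
        simp [AddMonoid.End.coe_mul, Function.comp_apply] }
  have h1 : f' (ρ g⁻¹ v) ∈ W := hW f' hv
  change ρ g⁻¹ (f (ρ g (ρ g⁻¹ v))) ∈ W at h1
  rw [map_apply_map_inv_apply] at h1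
  exact h1

theorem mem_isotypicComponents_iff_minimal {R M : Type*} [Ring R] [AddCommGroup M] [Module R M]
    [IsSemisimpleModule R M] {m : Submodule R M} :
    m ∈ isotypicComponents R M ↔ m.IsFullyInvariant ∧ m ≠ ⊥ ∧
      ∀ m' ≤ m, m'.IsFullyInvariant → m' ≠ ⊥ → m' = m := by
  constructor
  · intro h
    refine ⟨.of_mem_isotypicComponents h, (bot_lt_isotypicComponents h).ne',
      fun m' hle hinv hne => le_antisymm hle ?_⟩
    obtain ⟨S, hS, hs⟩ := (IsSemisimpleModule.eq_bot_or_exists_simple_le m').resolve_left hne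
    rw [eq_isotypicComponent_of_le h (hS.trans hle)]
    exact isFullyInvariant_iff_le_imp_isotypicComponent_le.1 hinv S hS
  · rintro ⟨hinv, hne, hmin⟩
    obtain ⟨S, hS, hs⟩ := (IsSemisimpleModule.eq_bot_or_exists_simple_le m).resolve_left hne
    exact ⟨S, hs, (hmin _ (isFullyInvariant_iff_le_imp_isotypicComponent_le.1 hinv S hS)
      (.isotypicComponent _ _ S) (bot_lt_isotypicComponent S).ne').symm⟩

theorem translateIso_mem_isotypicComponents {N : Subgroup G} [N.Normal]
    [IsSemisimpleModule (actionRing ρ N) V] (g : G) {W : Submodule (actionRing ρ N) V}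
    (hW : W ∈ isotypicComponents (actionRing ρ N) V) :
    translateIso g W ∈ isotypicComponents (actionRing ρ N) V := by
  rw [mem_isotypicComponents_iff_minimal] at hW ⊢
  obtain ⟨h1, h2, h3⟩ := hW
  refine ⟨isFullyInvariant_translate g h1, fun h => h2 ?_, fun m hm hinv hne => ?_⟩
  · rw [← (translateIso g).map_bot] at h
    exact (translateIso g).injective h
  · have := h3 (translateIso g⁻¹ m) ?_ (isFullyInvariant_translate g⁻¹ hinv) fun h => hne ?_
    · rw [← this, ← translateIso_mul, mul_inv_cancel, translateIso_one]
    · have := (translateIso g⁻¹).monotone hm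
      rwa [← translateIso_mul, inv_mul_cancel, translateIso_one] at this
    · rw [← (translateIso g⁻¹).map_bot] at h
      exact (translateIso g⁻¹).injective h

/-- The permutation action of the group on the isotypic components for a normal subgroup. -/
def componentPerm (N : Subgroup G) [N.Normal] [IsSemisimpleModule (actionRing ρ N) V] :
    G →* Equiv.Perm (isotypicComponents (actionRing ρ N) V) where
  toFun g :=
    { toFun := fun c => ⟨translateIso g c.1, translateIso_mem_isotypicComponents g c.2⟩
      invFun := fun c => ⟨translateIso g⁻¹ c.1, translateIso_mem_isotypicComponents g⁻¹ c.2⟩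
      left_inv := fun c => Subtype.ext (by
        simp only [← translateIso_mul, inv_mul_cancel, translateIso_one])
      right_inv := fun c => Subtype.ext (by
        simp only [← translateIso_mul, mul_inv_cancel, translateIso_one]) }
  map_one' := by ext c : 2; exact translateIso_one c.1
  map_mul' g h := by ext c : 2; exact translateIso_mul g h c.1

theorem card_eq_prod_card {R M ι : Type*} [Ring R] [AddCommGroup M] [Module R M] [Fintype ι]
    (N : ι → Submodule R M) (ind : iSupIndep N) (htop : ⨆ i, N i = ⊤) :
    Nat.card M = ∏ i, Nat.card (N i) := by
  classical
  rw [← Nat.card_pi]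
  exact Nat.card_congr ((ind.linearEquiv htop).symm.toEquiv.trans DFinsupp.equivFunOnFintype)

/-- The action on an invariant subgroup. -/
def restrictAction {H : Subgroup G} (W : AddSubgroup V) (h : ∀ g ∈ H, ∀ w ∈ W, ρ g w ∈ W) :
    H →* AddMonoid.End W where
  toFun g :=
    { toFun := fun w => ⟨ρ g w, h g g.2 w w.2⟩
      map_zero' := Subtype.ext (map_zero _)
      map_add' := fun x y => Subtype.ext (map_add _ _ _) }
  map_one' := by
    ext w
    change ρ (1 : G) (w : V) = w
    rw [map_one]; rfl
  map_mul' a b := by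
    ext w
    change ρ ((a : G) * b) (w : V) = ρ a (ρ b w)
    rw [map_mul]; rfl

end Clifford

section Imprimitive

universe u

variable {G V : Type u} [Group G] [AddCommGroup V] {ρ : G →* AddMonoid.End V}

/-- The stabilizer of an isotypic component acts irreducibly on it. -/
theorem IrrAction.restrict_component (hirr : IrrAction ρ) {N : Subgroup G} [N.Normal]
    [IsSemisimpleModule (actionRing ρ N) V] (c : isotypicComponents (actionRing ρ N) V)
    {H : Subgroup G} (hH : ∀ g, g ∈ H ↔ translateIso g c.1 = c.1)
    (h : ∀ g ∈ H, ∀ w ∈ c.1.toAddSubgroup, ρ g w ∈ c.1.toAddSubgroup) :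
    IrrAction (restrictAction c.1.toAddSubgroup h) := by
  intro W hW
  let W' : AddSubgroup V := W.map c.1.toAddSubgroup.subtype
  let rest : Submodule (actionRing ρ N) V := sSup (isotypicComponents (actionRing ρ N) V \ {c.1})
  have hdisj : Disjoint c.1 rest := sSupIndep_isotypicComponents _ V c.2
  let m : G → V →+ V := fun g => ρ g
  let T : AddSubgroup V := ⨆ g : G, W'.map (m g)
  have hT : ∀ g, ∀ w ∈ T, ρ g w ∈ T := by
    intro g w hw
    have hmap : T.map (m g) ≤ T := by
      rw [AddSubgroup.map_iSup]
      refine iSup_le fun k => ?_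
      rw [AddSubgroup.map_map]
      refine le_trans (le_of_eq ?_) (le_iSup (fun g => W'.map (m g)) (g * k))
      rw [show m (g * k) = (m g).comp (m k) from map_mul ρ g k]
    exact hmap ⟨w, hw, rfl⟩
  have hW'T : W' ≤ T := by
    refine le_trans (le_of_eq ?_) (le_iSup (fun g => W'.map (m g)) 1)
    rw [show m 1 = AddMonoidHom.id V from map_one ρ, AddSubgroup.map_id]
  rcases hirr T hT with h0 | h1
  · left
    rw [AddSubgroup.eq_bot_iff_forall]
    intro x hx
    have : (x : V) ∈ T := hW'T ⟨x, hx, rfl⟩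
    rw [h0, AddSubgroup.mem_bot] at this
    exact Subtype.ext this
  · right
    have hle : T ≤ W' ⊔ rest.toAddSubgroup := by
      refine iSup_le fun g => ?_
      by_cases hg : g ∈ H
      · refine le_trans ?_ le_sup_left
        rintro _ ⟨_, ⟨x, hx, rfl⟩, rfl⟩
        exact ⟨_, hW ⟨g, hg⟩ x hx, rfl⟩
      · refine le_trans ?_ le_sup_right
        rintro _ ⟨_, ⟨x, hx, rfl⟩, rfl⟩
        have h2 : translateIso g c.1 ≤ rest :=
          le_sSup ⟨translateIso_mem_isotypicComponents g c.2, fun h => hg ((hH g).2 h)⟩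
        exact h2 (apply_mem_translateIso x.2)
    rw [AddSubgroup.eq_top_iff']
    intro x
    have hx : (x : V) ∈ W' ⊔ rest.toAddSubgroup := hle (h1 ▸ AddSubgroup.mem_top _)
    obtain ⟨_, ⟨w, hw, rfl⟩, r, hr, hwr⟩ := AddSubgroup.mem_sup.1 hx
    have hrc : r ∈ c.1 := by
      have : r = (x : V) - (w : V) := by rw [← hwr]; simp
      rw [this]
      exact c.1.sub_mem x.2 w.2
    have hr0 : r = 0 := (Submodule.mem_bot _).1 (hdisj.le_bot ⟨hrc, hr⟩)
    have : w = x := Subtype.ext (by rw [← hwr, hr0, add_zero]; rfl)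
    exact this ▸ hw

theorem IrrAction.exists_translateIso_eq (hirr : IrrAction ρ) {N : Subgroup G} [N.Normal]
    [IsSemisimpleModule (actionRing ρ N) V] (c c' : isotypicComponents (actionRing ρ N) V) :
    ∃ g, translateIso g c.1 = c'.1 := by
  by_contra! h
  let T : Submodule (actionRing ρ N) V := ⨆ g : G, translateIso g c.1
  have hT : ∀ g, translateIso g T = T := by
    have hle : ∀ g, translateIso g T ≤ T := fun g => by
      rw [(translateIso g).map_iSup]
      refine iSup_le fun k => ?_
      rw [← translateIso_mul]
      exact le_iSup (fun g => translateIso g c.1) (g * k)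
    intro g
    refine le_antisymm (hle g) ?_
    have := (translateIso g).monotone (hle g⁻¹)
    rwa [← translateIso_mul, mul_inv_cancel, translateIso_one] at this
  rcases hirr.eq_bot_or_top T hT with h0 | h1
  · refine (bot_lt_isotypicComponents c.2).not_ge ?_
    rw [← h0, ← translateIso_one c.1]
    exact le_iSup (fun g => translateIso g c.1) 1
  · have hle : T ≤ sSup (isotypicComponents (actionRing ρ N) V \ {c'.1}) :=
      iSup_le fun g => le_sSup ⟨translateIso_mem_isotypicComponents g c.2, h g⟩
    have hdisj := sSupIndep_isotypicComponents (actionRing ρ N) V c'.2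
    refine (bot_lt_isotypicComponents c'.2).not_ge (hdisj le_rfl ?_)
    exact le_trans (h1 ▸ le_top) hle

/-- If the restriction to some normal subgroup is not isotypic, the isotypic components form a
system of imprimitivity, and the bounds for the components and for the permutation group combine. -/
theorem SharpOrderBound.of_not_isotypic [Finite G] [Finite V] [Nontrivial V] [Group.IsSolvable G]
    (hirr : IrrAction ρ) (hinj : Function.Injective ρ) (hV4 : Nat.card V ≠ 4)
    (ih : BoundBelow.{u} (Nat.card V)) (N : Subgroup G) [N.Normal]
    (hN : ¬ IsIsotypic (actionRing ρ N) V) : SharpOrderBound (Nat.card V) (Nat.card G) := by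
  have := hirr.isSemisimpleModule N
  let I := isotypicComponents (actionRing ρ N) V
  have : Finite I := inferInstance
  have := Fintype.ofFinite I
  have hind : iSupIndep fun c : I => c.1 :=
    sSupIndep_iff _ |>.1 (sSupIndep_isotypicComponents _ V)
  have htop : ⨆ c : I, c.1 = ⊤ := by
    rw [← sSup_eq_iSup']; exact sSup_isotypicComponents _ V
  have hI : Nontrivial I := by
    by_contra hI
    rw [not_nontrivial_iff_subsingleton] at hI
    rcases isEmpty_or_nonempty I with hE | ⟨⟨c⟩⟩
    · rw [iSup_of_empty] at htop
      exact bot_ne_top htop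
    · refine hN ?_
      have hc : c.1 = ⊤ := by
        rw [← htop]
        exact le_antisymm (le_iSup (fun c : I => c.1) c)
          (iSup_le fun c' => by rw [Subsingleton.elim c' c])
      have := IsIsotypic.isotypicComponents c.2
      rw [hc] at this
      exact Submodule.topEquiv.isIsotypic_iff.1 this
  let φ := componentPerm (ρ := ρ) N
  let H : I → Subgroup G := fun c => (MulAction.stabilizer (Equiv.Perm I) c).comap φ
  have hH : ∀ c g, g ∈ H c ↔ translateIso g c.1 = c.1 := fun c g => by
    change φ g c = c ↔ _
    rw [Subtype.ext_iff]; rfl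
  have hHinv : ∀ c : I, ∀ g ∈ H c, ∀ w ∈ c.1.toAddSubgroup, ρ g w ∈ c.1.toAddSubgroup := by
    intro c g hg w hw
    have := apply_mem_translateIso (g := g) (show w ∈ c.1 from hw)
    rwa [(hH c g).1 hg] at this
  let ψ : ∀ c : I, H c →* AddMonoid.End c.1.toAddSubgroup := fun c =>
    restrictAction c.1.toAddSubgroup (hHinv c)
  have hdvd := card_dvd_index_mul_prod φ.ker H (fun c g hg => by
      change φ g c = c
      rw [MonoidHom.mem_ker.1 hg]; rfl) ψ (by
    intro g hg h
    refine hinj ?_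
    rw [map_one]
    ext v
    have hv : v ∈ ⨆ c : I, c.1 := htop ▸ Submodule.mem_top
    have hgH : ∀ c, g ∈ H c := fun c => by
      change φ g c = c
      rw [MonoidHom.mem_ker.1 hg]; rfl
    induction hv using Submodule.iSup_induction' with
    | mem c x hx =>
      have := congrArg (fun f => (f ⟨x, hx⟩ : c.1.toAddSubgroup)) (h c (hgH c))
      exact congrArg Subtype.val this
    | zero => simp
    | add x y _ _ hx hy => rw [map_add, map_add, hx, hy])
  have hcard : ∀ c c' : I, Nat.card c.1 = Nat.card c'.1 := by
    intro c c'
    obtain ⟨g, hg⟩ := hirr.exists_translateIso_eq c c'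
    refine Nat.card_congr
      { toFun := fun x => ⟨ρ g x, hg ▸ apply_mem_translateIso x.2⟩
        invFun := fun x => ⟨ρ g⁻¹ x, by
          have : (x : V) ∈ translateIso g c.1 := by rw [hg]; exact x.2
          exact this⟩
        left_inv := fun x => Subtype.ext (map_inv_apply_map_apply g _)
        right_inv := fun x => Subtype.ext (map_apply_map_inv_apply g _) }
  obtain ⟨c₀⟩ : Nonempty I := inferInstance
  have hVcard : Nat.card V = Nat.card c₀.1 ^ Fintype.card I := by
    rw [card_eq_prod_card _ hind htop, Finset.prod_congr rfl fun c _ => hcard c c₀]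
    simp
  have hnt : ∀ c : I, Nontrivial c.1.toAddSubgroup := fun c =>
    inferInstanceAs (Nontrivial c.1)
  have hone : ∀ c : I, 1 < Nat.card c.1 := fun c => Finite.one_lt_card
  have hlt : ∀ c : I, Nat.card c.1 < Nat.card V := fun c => by
    rw [hVcard, ← hcard c c₀]
    exact lt_self_pow₀ (hone c) Fintype.one_lt_card
  refine SharpOrderBound.of_prod (s := φ.ker.index) (w := Nat.card c₀.1)
    (k := fun c => (ψ c).ker.index) ?_ (fun c => ?_) hVcard hV4 hdvd ?_
  · rw [← Nat.card_eq_fintype_card]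
    exact index_ker_perm_pow_three_le φ
  · rw [← hcard c c₀]
    exact ih c.1.toAddSubgroup (hlt c) (H c) (ψ c) (hirr.restrict_component c (hH c) (hHinv c))
  · exact mul_ne_zero Subgroup.index_ne_zero_of_finite
      (Finset.prod_ne_zero_iff.2 fun i _ => Subgroup.index_ne_zero_of_finite)

end Imprimitive

/-! ### Pairings with values in the units of a field -/

section Pairing

variable {F : Type*} [Field F]

/-- Distinct characters are linearly independent, so there are at most `|B|` of them. -/
theorem card_monoidHom_units_le (B : Type*) [Group B] [Finite B] :
    Nat.card (B →* Fˣ) ≤ Nat.card B := by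
  have := Fintype.ofFinite B
  have hinj : Function.Injective fun f : B →* Fˣ => (Units.coeHom F).comp f := by
    intro f g h
    ext b
    exact DFunLike.congr_fun h b
  have hli := (linearIndependent_monoidHom B F).comp _ hinj
  have hfin : Finite (B →* Fˣ) := hli.finite
  have := Fintype.ofFinite (B →* Fˣ)
  have h := hli.fintype_card_le_finrank
  rwa [Module.finrank_fintype_fun_eq_card, ← Nat.card_eq_fintype_card,
    ← Nat.card_eq_fintype_card] at h

theorem finite_monoidHom_units (B : Type*) [Group B] [Finite B] : Finite (B →* Fˣ) := by
  have hinj : Function.Injective fun f : B →* Fˣ => (Units.coeHom F).comp f := by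
    intro f g h
    ext b
    exact DFunLike.congr_fun h b
  exact ((linearIndependent_monoidHom B F).comp _ hinj).finite

/-- Both orders are powers of `r`, so that an inequality between them is a divisibility. -/
theorem index_ker_dvd_of_exponent {P B : Type*} [Group P] [Group B] [Finite B] {r : ℕ}
    (hr : r.Prime) (hB : ∀ x : B, x ^ r = 1) (κ : P →* (B →* Fˣ)) :
    κ.ker.index ∣ Nat.card B := by
  have := Fact.mk hr
  have := finite_monoidHom_units (F := F) B
  have h1 : IsPGroup r B := fun x => ⟨1, by rw [pow_one, hB]⟩
  have h2 : IsPGroup r κ.range := fun f => ⟨1, by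
    refine Subtype.ext (MonoidHom.ext fun x => ?_)
    change (f.1 ^ r ^ 1) x = 1
    rw [pow_one, MonoidHom.pow_apply, ← map_pow, hB, map_one]⟩
  obtain ⟨k, hk⟩ := IsPGroup.iff_card.1 h1
  obtain ⟨l, hl⟩ := IsPGroup.iff_card.1 h2
  have hle : Nat.card κ.range ≤ Nat.card B :=
    (Subgroup.card_le_card_group _).trans (card_monoidHom_units_le B)
  rw [Subgroup.index_ker, hk, hl]
  rw [hk, hl] at hle
  exact pow_dvd_pow r ((Nat.pow_le_pow_iff_right hr.one_lt).1 hle)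

/-- A group with a nondegenerate alternating pairing has square order: a maximal isotropic subgroup
is its own annihilator, hence dual to the quotient by it. -/
theorem exists_card_sq_eq {B : Type*} [Group B] [Finite B] (β : B →* (B →* Fˣ))
    (hinj : Function.Injective β) (halt : ∀ x, β x x = 1) :
    ∃ A : Subgroup B, Nat.card B = Nat.card A ^ 2 := by
  have hcomm : ∀ x y : B, x * y = y * x := fun x y => hinj (by
    rw [map_mul, map_mul]; exact mul_comm (β x) (β y))
  have hskew : ∀ x y, β x y = 1 → β y x = 1 := by
    intro x y h
    have := halt (x * y)
    simp only [map_mul, MonoidHom.mul_apply, halt, h, one_mul, mul_one] at this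
    exact this
  obtain ⟨A, hA, hmax⟩ := WellFounded.has_min (wellFounded_gt (α := Subgroup B))
    {A | ∀ x ∈ A, ∀ y ∈ A, β x y = 1} ⟨⊥, fun x hx y _ => by
      rw [Subgroup.mem_bot.1 hx, map_one, MonoidHom.one_apply]⟩
  have hperp : ∀ x, (∀ y ∈ A, β x y = 1) → x ∈ A := by
    intro x hx
    by_contra hxA
    have hlt : A < A ⊔ Subgroup.zpowers x := by
      refine lt_of_le_of_ne le_sup_left fun h => hxA ?_
      rw [h]
      exact (le_sup_right : _ ≤ A ⊔ Subgroup.zpowers x) (Subgroup.mem_zpowers x)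
    refine hmax (A ⊔ Subgroup.zpowers x) ?_ hlt
    have h1 : ∀ u, (∀ y ∈ A, β u y = 1) → β u x = 1 → ∀ y ∈ A ⊔ Subgroup.zpowers x, β u y = 1 := by
      intro u hu hux y hy
      have : A ⊔ Subgroup.zpowers x ≤ (β u).ker :=
        sup_le hu (by rwa [Subgroup.zpowers_le])
      exact this hy
    intro u hu y hy
    have : A ⊔ Subgroup.zpowers x ≤ ((MonoidHom.eval y).comp β).ker := by
      refine sup_le (fun a ha => ?_) ?_
      · exact h1 a (hA a ha) (hskew _ _ (hx a ha)) y hy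
      · rw [Subgroup.zpowers_le]
        exact h1 x hx (halt x) y hy
    exact this hu
  have hAn : A.Normal := ⟨fun a ha g => by
    rwa [hcomm g a, mul_assoc, mul_inv_cancel, mul_one]⟩
  have := finite_monoidHom_units (F := F) A
  have := finite_monoidHom_units (F := F) (B ⧸ A)
  have h1 : A.index ≤ Nat.card A := by
    let f : B →* (A →* Fˣ) := (MonoidHom.compHom' A.subtype).comp β
    have hf : f.ker = A := by
      ext x
      constructor
      · intro hx
        refine hperp x fun y hy => ?_
        exact DFunLike.congr_fun (MonoidHom.mem_ker.1 hx) (⟨y, hy⟩ : A)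
      · intro hx
        exact MonoidHom.ext fun y => hA x hx y y.2
    rw [← hf, Subgroup.index_ker]
    rw [hf]
    exact (Subgroup.card_le_card_group _).trans (card_monoidHom_units_le A)
  have h2 : Nat.card A ≤ A.index := by
    refine le_trans (Nat.card_le_card_of_injective
      (fun a : A => QuotientGroup.lift A (β a) fun y hy => hA a a.2 y hy) ?_)
      (card_monoidHom_units_le (F := F) (B ⧸ A))
    intro a b hab
    refine Subtype.ext (hinj (MonoidHom.ext fun y => ?_))
    exact DFunLike.congr_fun hab (y : B ⧸ A)
  exact ⟨A, by rw [← A.index_mul_card, le_antisymm h1 h2, sq]⟩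

/-- Elements of a group of units that are simultaneous eigenvectors, with distinct characters, for
conjugation by the group are linearly independent. -/
theorem card_le_finrank_of_characters {A M B : Type*} [Ring A] [Nontrivial A] [Algebra F A]
    [Module.Finite F A] [Group M] [Finite B] (T : M →* A) (s : B → M) (χ : B → (M →* F))
    (hχ : Function.Injective χ) (h : ∀ b y, T y * T (s b) = χ b y • (T (s b) * T y)) :
    Nat.card B ≤ Module.finrank F A := by
  have := Fintype.ofFinite B
  rw [Nat.card_eq_fintype_card]
  refine LinearIndependent.fintype_card_le_finrank (b := fun b => T (s b)) ?_
  rw [Fintype.linearIndependent_iff]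
  intro c hc b
  have hconj : ∀ y, ∑ b, (c b * χ b y) • T (s b) = 0 := by
    intro y
    have h1 : T y * (∑ b, c b • T (s b)) * T y⁻¹ = 0 := by rw [hc, mul_zero, zero_mul]
    rw [← h1, Finset.mul_sum, Finset.sum_mul]
    refine Finset.sum_congr rfl fun b _ => ?_
    have h2 : T y * T y⁻¹ = 1 := by rw [← map_mul, mul_inv_cancel, map_one]
    rw [mul_smul_comm, h b y, smul_mul_assoc, smul_mul_assoc, mul_assoc, h2, mul_one, mul_smul]
  by_contra hcb
  have hzero : T (s b) = 0 := by
    rw [← Module.forall_dual_apply_eq_zero_iff F]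
    intro l
    have hli := (linearIndependent_monoidHom M F).comp χ hχ
    rw [Fintype.linearIndependent_iff] at hli
    have h3 := hli (fun b => c b * l (T (s b))) (by
      funext y
      have h4 := congrArg l (hconj y)
      rw [map_sum, map_zero] at h4
      rw [Finset.sum_apply, Pi.zero_apply, ← h4]
      refine Finset.sum_congr rfl fun b _ => ?_
      rw [map_smul, Pi.smul_apply, smul_eq_mul, smul_eq_mul, Function.comp_apply]
      ring) b
    exact (mul_eq_zero.1 h3).resolve_left hcb
  have h5 : T (s b) * T (s b)⁻¹ = 1 := by rw [← map_mul, mul_inv_cancel, map_one]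
  rw [hzero, zero_mul] at h5
  exact zero_ne_one h5

end Pairing

/-! ### The commutator pairing -/

section Commutator

open scoped commutatorElement

variable {G : Type*} [Group G]

theorem commutator_mul_left {g g' m : G} (h : g * ⁅g', m⁆ = ⁅g', m⁆ * g) :
    ⁅g * g', m⁆ = ⁅g', m⁆ * ⁅g, m⁆ := by
  have h1 : ⁅g * g', m⁆ = g * ⁅g', m⁆ * g⁻¹ * ⁅g, m⁆ := by
    simp only [commutatorElement_def]; group
  rw [h1, h, mul_inv_cancel_right]

theorem commutator_mul_right {g m m' : G} (h : m * ⁅g, m'⁆ = ⁅g, m'⁆ * m) :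
    ⁅g, m * m'⁆ = ⁅g, m⁆ * ⁅g, m'⁆ := by
  have h1 : ⁅g, m * m'⁆ = ⁅g, m⁆ * (m * ⁅g, m'⁆ * m⁻¹) := by
    simp only [commutatorElement_def]; group
  rw [h1, h, mul_inv_cancel_right]

/-- The commutator pairing of two subgroups `P` and `M` that centralize `Z` and commute modulo `Z`,
with values in `Z` composed with a character `ι` of `Z`. It is trivial on `Z` in the second
variable. -/
def commutatorPairing {Z M P : Subgroup G} [Z.Normal] {A : Type*} [CommGroup A] (ι : Z →* A)
    (hPM : ∀ g ∈ P, ∀ m ∈ M, ⁅g, m⁆ ∈ Z) (hPZ : ∀ g ∈ P, ∀ z ∈ Z, g * z = z * g)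
    (hMZ : ∀ m ∈ M, ∀ z ∈ Z, m * z = z * m) : P →* (M ⧸ Z.subgroupOf M →* A) where
  toFun g := QuotientGroup.lift (Z.subgroupOf M)
    { toFun := fun m => ι ⟨⁅(g : G), (m : G)⁆, hPM g g.2 m m.2⟩
      map_one' := by
        rw [← map_one ι]
        exact congrArg ι (Subtype.ext (commutatorElement_one_right _))
      map_mul' := fun m m' => by
        rw [← map_mul]
        exact congrArg ι (Subtype.ext (commutator_mul_right
          (hMZ m m.2 _ (hPM g g.2 m' m'.2)))) }
    (fun m hm => by
      refine Eq.trans ?_ (map_one ι)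
      exact congrArg ι (Subtype.ext (commutatorElement_eq_one_iff_mul_comm.2
        (hPZ g g.2 m (Subgroup.mem_subgroupOf.1 hm)))))
  map_one' := by
    refine QuotientGroup.monoidHom_ext _ (MonoidHom.ext fun m => ?_)
    refine Eq.trans ?_ (map_one ι)
    exact congrArg ι (Subtype.ext (commutatorElement_one_left _))
  map_mul' g g' := by
    refine QuotientGroup.monoidHom_ext _ (MonoidHom.ext fun m => ?_)
    refine Eq.trans ?_ ((map_mul ι ⟨⁅(g' : G), (m : G)⁆, hPM g' g'.2 m m.2⟩
      ⟨⁅(g : G), (m : G)⁆, hPM g g.2 m m.2⟩).trans (mul_comm _ _))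
    exact congrArg ι (Subtype.ext (commutator_mul_left (hPZ g g.2 _ (hPM g' g'.2 m m.2))))

variable {Z M P : Subgroup G} [Z.Normal] {A : Type*} [CommGroup A] {ι : Z →* A}
  {hPM : ∀ g ∈ P, ∀ m ∈ M, ⁅g, m⁆ ∈ Z} {hPZ : ∀ g ∈ P, ∀ z ∈ Z, g * z = z * g}
  {hMZ : ∀ m ∈ M, ∀ z ∈ Z, m * z = z * m}

theorem commutatorPairing_apply (g : P) (m : M) :
    commutatorPairing ι hPM hPZ hMZ g (m : M ⧸ Z.subgroupOf M) =
      ι ⟨⁅(g : G), (m : G)⁆, hPM g g.2 m m.2⟩ := rfl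

theorem mem_ker_commutatorPairing (hι : Function.Injective ι) {g : P} :
    g ∈ (commutatorPairing ι hPM hPZ hMZ).ker ↔ ∀ m ∈ M, (g : G) * m = m * g := by
  rw [MonoidHom.mem_ker]
  constructor
  · intro h m hm
    have h1 : ι ⟨⁅(g : G), m⁆, hPM g g.2 m hm⟩ = 1 :=
      DFunLike.congr_fun h ((⟨m, hm⟩ : M) : M ⧸ Z.subgroupOf M)
    rw [← map_one ι] at h1
    exact commutatorElement_eq_one_iff_mul_comm.1 (congrArg Subtype.val (hι h1))
  · intro h
    refine QuotientGroup.monoidHom_ext _ (MonoidHom.ext fun m => ?_)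
    refine Eq.trans ?_ (map_one ι)
    exact congrArg ι (Subtype.ext (commutatorElement_eq_one_iff_mul_comm.2 (h m m.2)))

end Commutator

/-! ### Finite fields -/

theorem card_ringAut_dvd {F : Type*} [Field F] [Finite F] {p a : ℕ} (hp : p.Prime)
    (hF : Nat.card F = p ^ a) : Nat.card (F ≃+* F) ∣ a := by
  have := Fact.mk hp
  have hchar : CharP F p := by
    obtain ⟨q, hq⟩ := CharP.exists F
    have := Fintype.ofFinite F
    obtain ⟨n, hq', hn⟩ := FiniteField.card F q
    rw [← Nat.card_eq_fintype_card, hF] at hn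
    have : p = q := by
      have ha : a ≠ 0 := by
        rintro rfl
        rw [pow_zero] at hn
        exact (Nat.one_lt_pow n.ne_zero hq'.one_lt).ne hn
      have : p ∣ q ^ (n : ℕ) := hn ▸ dvd_pow_self p ha
      exact (Nat.prime_dvd_prime_iff_eq hp hq').1 (hp.dvd_of_dvd_pow this)
    exact this ▸ hq
  let := ZMod.algebra F p
  have hfin : Module.finrank (ZMod p) F = a := by
    have h1 := Module.natCard_eq_pow_finrank (K := ZMod p) (V := F)
    rw [hF, Nat.card_zmod] at h1
    exact (Nat.pow_right_injective hp.two_le h1).symm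
  have h2 := IsGalois.card_aut_eq_finrank (ZMod p) F
  rw [hfin] at h2
  rw [← h2]
  refine Subgroup.card_dvd_of_injective
    ({ toFun := fun f => AlgEquiv.ofRingEquiv (f := f) fun x =>
        DFunLike.congr_fun (Subsingleton.elim
          ((f : F →+* F).comp (algebraMap (ZMod p) F)) (algebraMap (ZMod p) F)) x
       map_one' := rfl
       map_mul' := fun _ _ => rfl } : (F ≃+* F) →* Gal(F/ZMod p)) ?_
  intro f g h
  ext x
  exact DFunLike.congr_fun h x

theorem card_dvd_card_sub_one {F A : Type*} [Field F] [Finite F] [Group A]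
    (f : A →* Fˣ) (hf : Function.Injective f) : Nat.card A ∣ Nat.card F - 1 := by
  rw [← Nat.card_units]
  exact Subgroup.card_dvd_of_injective f hf

/-! ### Actions all of whose restrictions to normal subgroups are isotypic -/

section Isotypic

universe u

variable {G V : Type u} [Group G] [AddCommGroup V] {ρ : G →* AddMonoid.End V}

/-- The ring generated by an abelian normal subgroup with isotypic restriction is a field: the
kernel of each of its elements is a fully invariant submodule. -/
theorem isField_actionRing [Finite V] [Nontrivial V] (hirr : IrrAction ρ) (Z : Subgroup G)
    [Z.Normal] (hZ : ∀ x ∈ Z, ∀ y ∈ Z, x * y = y * x) (hiso : IsIsotypic (actionRing ρ Z) V) :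
    IsField (actionRing ρ Z) := by
  have := hirr.isSemisimpleModule Z
  have hcomm : ∀ r s : actionRing ρ Z, r * s = s * r :=
    (Subring.isMulCommutative_closure (s := ρ '' Z) (by
      rintro _ ⟨x, hx, rfl⟩ _ ⟨y, hy, rfl⟩
      rw [← map_mul, ← map_mul, hZ x hx y hy])).is_comm.comm
  have hfin : Finite (AddMonoid.End V) :=
    Finite.of_injective (fun f : AddMonoid.End V => (f : V → V)) DFunLike.coe_injective
  have hker : ∀ r : actionRing ρ Z, r ≠ 0 → ∀ v : V, r • v = 0 → v = 0 := by
    intro r hr v hv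
    let K : Submodule (actionRing ρ Z) V :=
      { carrier := {v | r • v = 0}
        add_mem' := fun {a b} ha hb => by
          change r • (a + b) = 0
          rw [smul_add, show r • a = 0 from ha, show r • b = 0 from hb, add_zero]
        zero_mem' := smul_zero r
        smul_mem' := fun s v hv => by
          change r • s • v = 0
          rw [smul_smul, hcomm, ← smul_smul, show r • v = 0 from hv, smul_zero] }
    have hK : K.IsFullyInvariant := by
      intro f v hv
      change r • f v = 0
      rw [← map_smul, show r • v = 0 from hv, map_zero]
    rcases isIsotypic_iff_isFullyInvariant_imp_bot_or_top.1 hiso K hK with h | h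
    · have : v ∈ K := hv
      rwa [h, Submodule.mem_bot] at this
    · refine absurd (Subtype.ext (AddMonoidHom.ext fun v => ?_)) hr
      have : v ∈ K := h ▸ Submodule.mem_top
      exact this
  refine ⟨⟨0, 1, fun h => ?_⟩, hcomm, fun {r} hr => ?_⟩
  · obtain ⟨v, hv⟩ := exists_ne (0 : V)
    apply hv
    rw [← one_smul (actionRing ρ Z) v, ← h, zero_smul]
  · have hinj : Function.Injective fun s : actionRing ρ Z => r * s := by
      intro s s' h
      refine Subtype.ext (AddMonoidHom.ext fun v => ?_)
      change s • v = s' • v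
      rw [← sub_eq_zero]
      refine hker r hr _ ?_
      rw [smul_sub, smul_smul, smul_smul, show r * s = r * s' from h, sub_self]
    exact (Finite.surjective_of_injective hinj) 1

/-- Conjugation on the ring generated by a normal subgroup. -/
def conjRingAut (ρ : G →* AddMonoid.End V) (Z : Subgroup G) [Z.Normal] :
    G →* (actionRing ρ Z ≃+* actionRing ρ Z) where
  toFun g :=
    { toFun := fun r => ⟨ρ g * r * ρ g⁻¹, conj_mem_actionRing g r.2⟩
      invFun := fun r => ⟨ρ g⁻¹ * r * ρ g, by
        have := conj_mem_actionRing g⁻¹ r.2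
        rwa [inv_inv] at this⟩
      left_inv := fun r => Subtype.ext (AddMonoidHom.ext fun v => by
        change ρ g⁻¹ (ρ g ((r : AddMonoid.End V) (ρ g⁻¹ (ρ g v)))) = (r : AddMonoid.End V) v
        simp)
      right_inv := fun r => Subtype.ext (AddMonoidHom.ext fun v => by
        change ρ g (ρ g⁻¹ ((r : AddMonoid.End V) (ρ g (ρ g⁻¹ v)))) = (r : AddMonoid.End V) v
        simp)
      map_mul' := fun r s => Subtype.ext (AddMonoidHom.ext fun v => by
        change ρ g ((r : AddMonoid.End V) ((s : AddMonoid.End V) (ρ g⁻¹ v))) =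
          ρ g ((r : AddMonoid.End V) (ρ g⁻¹ (ρ g ((s : AddMonoid.End V) (ρ g⁻¹ v)))))
        simp)
      map_add' := fun r s => Subtype.ext (AddMonoidHom.ext fun v => by
        change ρ g ((r : AddMonoid.End V) (ρ g⁻¹ v) + (s : AddMonoid.End V) (ρ g⁻¹ v)) = _
        rw [map_add]; rfl) }
  map_one' := by
    refine RingEquiv.ext fun r => Subtype.ext ?_
    change ρ 1 * (r : AddMonoid.End V) * ρ 1⁻¹ = r
    rw [inv_one, map_one, one_mul, mul_one]
  map_mul' g h := by
    refine RingEquiv.ext fun r => Subtype.ext ?_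
    change ρ (g * h) * (r : AddMonoid.End V) * ρ (g * h)⁻¹ =
      ρ g * (ρ h * (r : AddMonoid.End V) * ρ h⁻¹) * ρ g⁻¹
    rw [mul_inv_rev, map_mul, map_mul]
    simp only [mul_assoc]

/-- The field of scalars generated by an abelian normal subgroup `Z`, with its numerical
invariants: `V` is a vector space over it, `G` acts on it through a group of automorphisms with
kernel inside the centralizer of `Z`. -/
theorem exists_scalar_field [Finite V] [Nontrivial V] (hirr : IrrAction ρ)
    (hinj : Function.Injective ρ) (Z : Subgroup G) [Z.Normal]
    (hZ : ∀ x ∈ Z, ∀ y ∈ Z, x * y = y * x) (hiso : IsIsotypic (actionRing ρ Z) V) :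
    ∃ (F : Type u) (_ : Field F) (_ : Finite F) (ι : Z →* Fˣ) (p a d : ℕ),
      Function.Injective ι ∧ p.Prime ∧ a ≠ 0 ∧ d ≠ 0 ∧ Nat.card F = p ^ a ∧
      Nat.card V = Nat.card F ^ d ∧ (Subgroup.centralizer (Z : Set G)).index ∣ a ∧
      ∀ D : Subgroup G, Z ≤ D → ∀ Y : Submodule (actionRing ρ D) V, Y ≠ ⊥ →
        Nat.card F ≤ Nat.card Y := by
  have hF := isField_actionRing hirr Z hZ hiso
  let _ : Field (actionRing ρ Z) := hF.toField
  have hfin : Finite (AddMonoid.End V) :=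
    Finite.of_injective (fun f : AddMonoid.End V => (f : V → V)) DFunLike.coe_injective
  have hfinF : Finite (actionRing ρ Z) := inferInstance
  let ι₀ : Z →* actionRing ρ Z :=
    { toFun := fun z => ⟨ρ z, map_mem_actionRing z.2⟩
      map_one' := Subtype.ext (map_one ρ)
      map_mul' := fun x y => Subtype.ext (map_mul ρ (x : G) y) }
  obtain ⟨p, hp⟩ := CharP.exists (actionRing ρ Z)
  have := Fintype.ofFinite (actionRing ρ Z)
  obtain ⟨a, hpp, ha⟩ := FiniteField.card (actionRing ρ Z) p
  rw [← Nat.card_eq_fintype_card] at ha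
  have hV := Module.natCard_eq_pow_finrank (K := actionRing ρ Z) (V := V)
  refine ⟨actionRing ρ Z, inferInstance, hfinF, ι₀.toHomUnits, p, a,
    Module.finrank (actionRing ρ Z) V, ?_, hpp, a.ne_zero, ?_, ha, hV, ?_, ?_⟩
  · intro x y h
    have h1 : ι₀ x = ι₀ y := congrArg Units.val h
    exact Subtype.ext (hinj (congrArg Subtype.val h1))
  · intro h
    rw [h, pow_zero] at hV
    exact (Finite.one_lt_card (α := V)).ne' hV
  · have hle : (conjRingAut ρ Z).ker ≤ Subgroup.centralizer (Z : Set G) := by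
      intro g hg
      rw [Subgroup.mem_centralizer_iff]
      intro z hz
      have h1 := DFunLike.congr_fun (MonoidHom.mem_ker.1 hg) (ι₀ ⟨z, hz⟩)
      have h2 : ρ g * ρ z * ρ g⁻¹ = ρ z := congrArg Subtype.val h1
      rw [← map_mul, ← map_mul] at h2
      exact (mul_inv_eq_iff_eq_mul.1 (hinj h2)).symm
    refine (Subgroup.index_dvd_of_le hle).trans ?_
    rw [Subgroup.index_ker]
    exact (Subgroup.card_subgroup_dvd_card _).trans (card_ringAut_dvd hpp ha)
  · intro D hZD Y hY
    obtain ⟨y, hy, hy0⟩ := Submodule.exists_mem_ne_zero_of_ne_bot hY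
    refine Nat.card_le_card_of_injective
      (fun r : actionRing ρ Z => (⟨(r : AddMonoid.End V) y,
        Y.smul_mem (⟨r, actionRing_mono hZD r.2⟩ : actionRing ρ D) hy⟩ : Y)) ?_
    intro r s h
    have h1 : r • y = s • y := congrArg Subtype.val h
    by_contra hne
    have h2 : (r - s) • y = 0 := by rw [sub_smul, h1, sub_self]
    obtain ⟨t, ht⟩ := hF.mul_inv_cancel (sub_ne_zero.2 hne)
    rw [hF.mul_comm] at ht
    apply hy0
    rw [← one_smul (actionRing ρ Z) y, ← ht, mul_smul, h2, smul_zero]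

theorem IrrAction.of_isSimpleModule {D : Subgroup G} {Y : Submodule (actionRing ρ D) V}
    (hY : IsSimpleModule (actionRing ρ D) Y)
    (h : ∀ g ∈ D, ∀ w ∈ Y.toAddSubgroup, ρ g w ∈ Y.toAddSubgroup) :
    IrrAction (restrictAction Y.toAddSubgroup h) := by
  intro W hW
  rw [isSimpleModule_iff_isAtom] at hY
  let W' : Submodule (actionRing ρ D) V := invariantSubmodule (W.map Y.toAddSubgroup.subtype) (by
    rintro g hg _ ⟨w, hw, rfl⟩
    exact ⟨_, hW ⟨g, hg⟩ w hw, rfl⟩)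
  have hle : W' ≤ Y := by
    rintro _ ⟨w, hw, rfl⟩
    exact w.2
  rcases hY.le_iff.1 hle with h0 | h1
  · left
    rw [AddSubgroup.eq_bot_iff_forall]
    intro x hx
    have : (x : V) ∈ W' := ⟨x, hx, rfl⟩
    rw [h0, Submodule.mem_bot] at this
    exact Subtype.ext this
  · right
    rw [AddSubgroup.eq_top_iff']
    intro x
    have : (x : V) ∈ W' := by rw [h1]; exact x.2
    obtain ⟨w, hw, hwx⟩ := this
    exact (Subtype.ext hwx : w = x) ▸ hw

theorem apply_smul_of_commute {D : Subgroup G} {m : G} (hm : ∀ d ∈ D, m * d = d * m)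
    (r : actionRing ρ D) (v : V) : ρ m (r • v) = r • ρ m v := by
  have hle : actionRing ρ D ≤ Subring.centralizer {ρ m} := by
    refine Subring.closure_le.2 ?_
    rintro _ ⟨d, hd, rfl⟩
    rw [SetLike.mem_coe, Subring.mem_centralizer_iff]
    intro f hf
    rw [Set.mem_singleton_iff.1 hf]
    rw [← map_mul, ← map_mul, hm d hd]
  have h := Subring.mem_centralizer_iff.1 (hle r.2) (ρ m) rfl
  exact congrArg (fun f : AddMonoid.End V => f v) h

open scoped commutatorElement

/-- If `V` restricted to `D` is a sum of `t` copies of the simple module `Y`, a group `M`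
commuting with `D` acts on `V` by matrices of size `t` over the field of endomorphisms of `Y`. When
the commutators of `M` act as scalars and pair `M` modulo `Z` nondegenerately, coset
representatives are linearly independent matrices, so there are at most `t ^ 2` of them. -/
theorem exists_simple_summand [Finite V] [Nontrivial V] (hirr : IrrAction ρ)
    (hinj : Function.Injective ρ) (D : Subgroup G) [D.Normal]
    (hiso : IsIsotypic (actionRing ρ D) V) {Z M : Subgroup G} [Finite M] [Z.Normal] (hZD : Z ≤ D)
    (hZM : Z ≤ M) (hMD : ∀ m ∈ M, ∀ d ∈ D, m * d = d * m)
    (hMZ : ∀ x ∈ M, ∀ y ∈ M, ⁅x, y⁆ ∈ Z)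
    (hcent : ∀ x ∈ M, (∀ y ∈ M, y * x = x * y) → x ∈ Z) :
    ∃ (t : ℕ) (Y : Submodule (actionRing ρ D) V), IsSimpleModule (actionRing ρ D) Y ∧
      Nat.card V = Nat.card Y ^ t ∧ (∀ g ∈ D, (∀ y ∈ Y, ρ g y = y) → g = 1) ∧
      Nat.card (M ⧸ Z.subgroupOf M) ≤ t ^ 2 := by
  classical
  have := hirr.isSemisimpleModule D
  obtain ⟨t, ht, Y, hY, ⟨e⟩⟩ := hiso.linearEquiv_fun
  refine ⟨t, Y, hY, ?_, ?_, ?_⟩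
  · rw [Nat.card_congr e.toEquiv, Nat.card_pi]; simp
  · intro g hg h
    refine hinj (AddMonoidHom.ext fun v => ?_)
    rw [map_one]
    change (⟨ρ g, map_mem_actionRing hg⟩ : actionRing ρ D) • v = v
    apply e.injective
    rw [map_smul]
    funext i
    exact Subtype.ext (h _ (e v i).2)
  let R := actionRing ρ D
  have hfin : Finite (Module.End R Y) :=
    Finite.of_injective (fun f : Module.End R Y => (f : Y → Y)) DFunLike.coe_injective
  let _ : Field (Module.End R Y) := littleWedderburn (Module.End R Y)
  let T : M →* Module.End R V :=
    { toFun := fun m =>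
        { toFun := fun v => ρ m v
          map_add' := fun v w => map_add _ v w
          map_smul' := fun r v => apply_smul_of_commute (hMD m m.2) r v }
      map_one' := LinearMap.ext fun v =>
        congrArg (fun f : AddMonoid.End V => f v) (map_one ρ)
      map_mul' := fun m m' => LinearMap.ext fun v =>
        congrArg (fun f : AddMonoid.End V => f v) (map_mul ρ (m : G) m') }
  let S : Z →* Module.End R Y :=
    { toFun := fun z =>
        { toFun := fun y => ⟨ρ z y, apply_mem_of_mem Y (hZD z.2) y.2⟩
          map_add' := fun v w => Subtype.ext (map_add _ _ _)
          map_smul' := fun r v => Subtype.ext (apply_smul_of_commute (hMD z (hZM z.2)) r v) }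
      map_one' := LinearMap.ext fun v =>
        Subtype.ext (congrArg (fun f : AddMonoid.End V => f v) (map_one ρ))
      map_mul' := fun m m' => LinearMap.ext fun v =>
        Subtype.ext (congrArg (fun f : AddMonoid.End V => f v) (map_mul ρ (m : G) m')) }
  let Φ : Module.End R V ≃+* Matrix (Fin t) (Fin t) (Module.End R Y) :=
    (LinearEquiv.conjRingEquiv e).trans (endVecRingEquivMatrixEnd (Fin t) R Y)
  have hΦ : ∀ z : Z, Φ (T ⟨z, hZM z.2⟩) = S z • (1 : Matrix (Fin t) (Fin t) (Module.End R Y)) := by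
    intro z
    ext i j y : 3
    have h1 : Φ (T ⟨z, hZM z.2⟩) i j y = e (ρ z (e.symm (Pi.single j y))) i := rfl
    have h2 : e (ρ z (e.symm (Pi.single j y))) =
        (⟨ρ z, map_mem_actionRing (hZD z.2)⟩ : R) • (Pi.single j y : Fin t → Y) := by
      have := map_smul e (⟨ρ z, map_mem_actionRing (hZD z.2)⟩ : R) (e.symm (Pi.single j y))
      rwa [e.apply_symm_apply] at this
    rw [h1, h2, Matrix.smul_apply, Pi.smul_apply]
    by_cases hij : i = j
    · subst hij
      rw [Pi.single_eq_same, Matrix.one_apply_eq, smul_eq_mul, mul_one]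
      rfl
    · rw [Pi.single_eq_of_ne hij, Matrix.one_apply_ne hij, smul_zero, smul_zero]
      rfl
  have hTΦ : ∀ x y : M, Φ (T x) * Φ (T y) =
      S ⟨⁅(x : G), (y : G)⁆, hMZ x x.2 y y.2⟩ • (Φ (T y) * Φ (T x)) := by
    intro x y
    have h1 : x * y = ⟨⁅(x : G), (y : G)⁆, hZM (hMZ x x.2 y y.2)⟩ * (y * x) := by
      refine Subtype.ext ?_
      change (x : G) * y = ⁅(x : G), (y : G)⁆ * (y * x)
      rw [commutatorElement_def]; group
    rw [← map_mul, ← map_mul, h1, map_mul, map_mul, hΦ ⟨_, hMZ x x.2 y y.2⟩, smul_mul_assoc,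
      one_mul, map_mul, map_mul]
  have hMcZ : ∀ m ∈ M, ∀ z ∈ Z, m * z = z * m := fun m hm z hz => hMD m hm z (hZD hz)
  have hS : Function.Injective S.toHomUnits := by
    intro z z' h
    have h1 : S z = S z' := congrArg Units.val h
    refine Subtype.ext (hinj (AddMonoidHom.ext fun v => ?_))
    have h2 : ∀ z : Z, ∀ i, (e (ρ z v) i : V) = ρ z (e v i) := by
      intro z i
      have := congrFun (map_smul e (⟨ρ z, map_mem_actionRing (hZD z.2)⟩ : R) v) i
      exact congrArg Subtype.val this
    apply e.injective
    funext i
    refine Subtype.ext ?_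
    exact (h2 z i).trans ((congrArg Subtype.val (DFunLike.congr_fun h1 (e v i))).trans
      (h2 z' i).symm)
  let κ := commutatorPairing S.toHomUnits hMZ hMcZ hMcZ
  let χ : M ⧸ Z.subgroupOf M → (M →* Module.End R Y) := fun b =>
    (Units.coeHom _).comp ((MonoidHom.eval b).comp κ)
  have hχ : Function.Injective χ := by
    intro b b' h
    have h1 : ∀ y, κ y b = κ y b' := fun y => Units.ext (DFunLike.congr_fun h y)
    rw [← inv_mul_eq_one]
    obtain ⟨m, hm⟩ := QuotientGroup.mk_surjective (b⁻¹ * b')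
    have h2 : ∀ y : M, κ y (m : M ⧸ Z.subgroupOf M) = 1 := fun y => by
      rw [hm, map_mul, map_inv, h1 y, inv_mul_cancel]
    rw [← hm, QuotientGroup.eq_one_iff, Subgroup.mem_subgroupOf]
    refine hcent m m.2 fun y hy => ?_
    have h3 := h2 ⟨y, hy⟩
    rw [commutatorPairing_apply, ← map_one S.toHomUnits] at h3
    exact commutatorElement_eq_one_iff_mul_comm.1 (congrArg Subtype.val (hS h3))
  have hrank := card_le_finrank_of_characters (F := Module.End R Y)
    (A := Matrix (Fin t) (Fin t) (Module.End R Y))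
    ((Φ : Module.End R V →* Matrix (Fin t) (Fin t) (Module.End R Y)).comp T) Quotient.out χ hχ
    (fun b y => by
      have h1 : χ b y = S ⟨⁅(y : G), (Quotient.out b : M)⁆, hMZ y y.2 _ (Quotient.out b).2⟩ := by
        conv_lhs => rw [← Quotient.out_eq b]
        rfl
      rw [h1]
      exact hTΦ y (Quotient.out b))
  rwa [Module.finrank_matrix, Module.finrank_self, Fintype.card_fin, mul_one, ← sq] at hrank

end Isotypic

/-! ### The primitive case -/

section Primitive

open scoped commutatorElement IsMulCommutative

theorem exists_maximal_abelian_normal (G : Type*) [Group G] [Finite G] :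
    ∃ Z : Subgroup G, Z.Normal ∧ (∀ x ∈ Z, ∀ y ∈ Z, x * y = y * x) ∧
      ∀ Z' : Subgroup G, Z'.Normal → (∀ x ∈ Z', ∀ y ∈ Z', x * y = y * x) → Z ≤ Z' → Z' = Z := by
  obtain ⟨Z, ⟨hn, hc⟩, hmax⟩ := WellFounded.has_min (wellFounded_gt (α := Subgroup G))
    {Z | Z.Normal ∧ ∀ x ∈ Z, ∀ y ∈ Z, x * y = y * x} ⟨⊥, inferInstance, fun x hx y hy => by
      rw [Subgroup.mem_bot.1 hx, Subgroup.mem_bot.1 hy]⟩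
  refine ⟨Z, hn, hc, fun Z' hn' hc' hle => ?_⟩
  by_contra hne
  exact hmax Z' ⟨hn', hc'⟩ (lt_of_le_of_ne hle (Ne.symm hne))

/-- The conjugation action on an abelian normal subgroup of a quotient, written additively. -/
def conjAction {G Q : Type*} [Group G] [Group Q] (π : G →* Q) (N : Subgroup Q) [N.Normal]
    [IsMulCommutative N] : G →* AddMonoid.End (Additive N) where
  toFun g := MonoidHom.toAdditive ((MulAut.conjNormal (π g) : MulAut N) : N →* N)
  map_one' := by
    refine AddMonoidHom.ext fun x => ?_
    change Additive.ofMul (MulAut.conjNormal (π 1) x.toMul) = x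
    rw [map_one, map_one]; rfl
  map_mul' g h := by
    refine AddMonoidHom.ext fun x => ?_
    change Additive.ofMul (MulAut.conjNormal (π (g * h)) x.toMul) =
      Additive.ofMul (MulAut.conjNormal (π g) (MulAut.conjNormal (π h) x.toMul))
    rw [map_mul, map_mul]; rfl

/-- Conjugation on a minimal normal subgroup is irreducible. -/
theorem irrAction_conjAction {G Q : Type*} [Group G] [Group Q] {π : G →* Q}
    (hπ : Function.Surjective π) (N : Subgroup Q) [N.Normal] [IsMulCommutative N]
    (hmin : ∀ L ≤ N, L.Normal → L = ⊥ ∨ L = N) : IrrAction (conjAction π N) := by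
  intro W hW
  let L : Subgroup Q := (AddSubgroup.toSubgroup' W).map N.subtype
  have hL : L ≤ N := by rintro _ ⟨x, -, rfl⟩; exact x.2
  have hLn : L.Normal := ⟨by
    rintro _ ⟨x, hx, rfl⟩ q
    obtain ⟨g, rfl⟩ := hπ q
    exact ⟨(conjAction π N g (Additive.ofMul x)).toMul, hW g _ hx, rfl⟩⟩
  rcases hmin L hL hLn with h | h
  · left
    rw [AddSubgroup.eq_bot_iff_forall]
    intro x hx
    have : ((x.toMul : N) : Q) ∈ L := ⟨x.toMul, hx, rfl⟩
    rw [h, Subgroup.mem_bot] at this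
    have h1 : x.toMul = 1 := Subtype.ext this
    exact h1
  · right
    rw [AddSubgroup.eq_top_iff']
    intro x
    have : ((x.toMul : N) : Q) ∈ L := by rw [h]; exact x.toMul.2
    obtain ⟨y, hy, hyx⟩ := this
    have h1 : Additive.ofMul y = x := Subtype.ext hyx
    exact h1 ▸ hy

theorem sq_lt_three_pow (e : ℕ) : e ^ 2 < 3 ^ e := by
  induction e with
  | zero => norm_num
  | succ e ih =>
    rcases (show e = 0 ∨ e = 1 ∨ 2 ≤ e by omega) with rfl | rfl | h
    · norm_num
    · norm_num
    · rw [pow_succ 3]; nlinarith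

universe u

variable {G V : Type u} [Group G] [AddCommGroup V] {ρ : G →* AddMonoid.End V}

/-- The primitive case: `Z` is a maximal abelian normal subgroup, `M / Z` a minimal normal subgroup
of `G / Z` centralizing `Z`, and `D` the centralizer of `M`. The order of `G` is the product of the
orders of the group induced on `M / Z`, a group of field automorphisms, a group of characters of
`M / Z`, and `D`. -/
theorem SharpOrderBound.of_isotypic [Finite G] [Finite V] [Nontrivial V] [Group.IsSolvable G]
    (hirr : IrrAction ρ) (hinj : Function.Injective ρ) (hV4 : Nat.card V ≠ 4)
    (ih : BoundBelow.{u} (Nat.card V))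
    (hiso : ∀ (N : Subgroup G) [N.Normal], IsIsotypic (actionRing ρ N) V) :
    SharpOrderBound (Nat.card V) (Nat.card G) := by
  obtain ⟨Z, hZn, hZc, hZmax⟩ := exists_maximal_abelian_normal G
  obtain ⟨F, _, _, ι, p, a, d, hι, hp, ha, hd, hF, hV, hC, hY⟩ :=
    exists_scalar_field hirr hinj Z hZc (hiso Z)
  let C := Subgroup.centralizer (Z : Set G)
  have hCn : C.Normal := inferInstance
  have hCZ : ∀ g ∈ C, ∀ z ∈ Z, g * z = z * g := fun g hg z hz =>
    (Subgroup.mem_centralizer_iff.1 hg z hz).symm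
  have hZC : Z ≤ C := fun z hz => Subgroup.mem_centralizer_iff.2 fun x hx => hZc x hx z hz
  have hZF : Nat.card Z ∣ Nat.card F - 1 := card_dvd_card_sub_one ι hι
  by_cases hCleZ : C ≤ Z
  · refine SharpOrderBound.of_semilinear hp ha hd (by rw [hV, hF]) hV4 ?_
    rw [← C.index_mul_card, mul_comm, le_antisymm hCleZ hZC, ← hF]
    refine Nat.mul_dvd_mul hZF ?_
    rw [← le_antisymm hCleZ hZC]
    exact hC
  let π : G →* G ⧸ Z := QuotientGroup.mk' Z
  have hπ : Function.Surjective π := QuotientGroup.mk'_surjective Z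
  have hπ1 : ∀ g, π g = 1 ↔ g ∈ Z := fun g => QuotientGroup.eq_one_iff g
  have hCmn : (C.map π).Normal := hCn.map π hπ
  have hCm0 : C.map π ≠ ⊥ := fun h => hCleZ fun g hg => by
    have : π g ∈ C.map π := ⟨g, hg, rfl⟩
    rw [h, Subgroup.mem_bot] at this
    exact (hπ1 g).1 this
  obtain ⟨N, hNC, hNn, hN0, hNmin, hNc, r, hr, hNr⟩ := exists_minimal_normal (C.map π) hCm0
  have : IsMulCommutative N := ⟨⟨fun x y => Subtype.ext (hNc x x.2 y y.2)⟩⟩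
  let M : Subgroup G := N.comap π
  have hMn : M.Normal := hNn.comap π
  have hZM : Z ≤ M := fun z hz => by
    change π z ∈ N
    rw [(hπ1 z).2 hz]; exact N.one_mem
  have hMC : M ≤ C := fun m hm => by
    obtain ⟨c, hc, hcm⟩ := hNC hm
    have h1 : c⁻¹ * m ∈ Z := QuotientGroup.eq.1 hcm
    have := C.mul_mem hc (hZC h1)
    rwa [mul_inv_cancel_left] at this
  have hMM : ∀ x ∈ M, ∀ y ∈ M, ⁅x, y⁆ ∈ Z := fun x hx y hy => by
    rw [← hπ1, map_commutatorElement]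
    exact commutatorElement_eq_one_iff_mul_comm.2 (hNc _ hx _ hy)
  have hMr : ∀ x ∈ M, x ^ r ∈ Z := fun x hx => by
    rw [← hπ1, map_pow]; exact hNr _ hx
  have hMZ : ∀ m ∈ M, ∀ z ∈ Z, m * z = z * m := fun m hm => hCZ m (hMC hm)
  let D := Subgroup.centralizer (M : Set G)
  have hDn : D.Normal := inferInstance
  have hMD : ∀ m ∈ M, ∀ d ∈ D, m * d = d * m := fun m hm d hd =>
    Subgroup.mem_centralizer_iff.1 hd m hm
  have hZD : Z ≤ D := fun z hz => Subgroup.mem_centralizer_iff.2 fun m hm => hMZ m hm z hz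
  have hcent : ∀ x ∈ M, (∀ y ∈ M, y * x = x * y) → x ∈ Z := fun x hx h => by
    have h1 : M ⊓ D = Z := hZmax (M ⊓ D) inferInstance
      (fun x hx y hy => hMD x hx.1 y hy.2) (le_inf hZM hZD)
    rw [← h1]
    exact ⟨hx, Subgroup.mem_centralizer_iff.2 h⟩
  obtain ⟨t, Y, hYs, hVt, hfaith, hBt⟩ :=
    exists_simple_summand hirr hinj D (hiso D) hZD hZM hMD hMM hcent
  -- The pairing of `M / Z` with itself.
  let κ := commutatorPairing ι hMM hMZ hMZ
  have hκ1 : ∀ m ∈ Z.subgroupOf M, m ∈ κ.ker := fun m hm =>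
    (mem_ker_commutatorPairing hι).2 fun m' hm' => (hMZ m' hm' m hm).symm
  let β : M ⧸ Z.subgroupOf M →* (M ⧸ Z.subgroupOf M →* Fˣ) :=
    QuotientGroup.lift (Z.subgroupOf M) κ hκ1
  have hβ : Function.Injective β := by
    rw [injective_iff_map_eq_one]
    intro b hb
    obtain ⟨m, rfl⟩ := QuotientGroup.mk_surjective b
    have h1 : m ∈ κ.ker := hb
    rw [QuotientGroup.eq_one_iff, Subgroup.mem_subgroupOf]
    exact hcent m m.2 fun y hy => ((mem_ker_commutatorPairing hι).1 h1 y hy).symm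
  have hβalt : ∀ b, β b b = 1 := by
    intro b
    obtain ⟨m, rfl⟩ := QuotientGroup.mk_surjective b
    refine Eq.trans ?_ (map_one ι)
    exact congrArg ι (Subtype.ext (commutatorElement_self _))
  have hBr : ∀ b : M ⧸ Z.subgroupOf M, b ^ r = 1 := by
    intro b
    obtain ⟨m, rfl⟩ := QuotientGroup.mk_surjective b
    rw [← QuotientGroup.mk_pow, QuotientGroup.eq_one_iff, Subgroup.mem_subgroupOf]
    exact hMr m m.2
  have hBN : Nat.card (M ⧸ Z.subgroupOf M) = Nat.card N := by
    let f : M →* N := π.subgroupComap N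
    have hf : f.ker = Z.subgroupOf M := by
      ext m
      rw [MonoidHom.mem_ker, Subgroup.mem_subgroupOf, ← hπ1, Subtype.ext_iff]
      rfl
    have h1 := Subgroup.index_ker f
    rw [hf, MonoidHom.range_eq_top.2 (π.subgroupComap_surjective_of_surjective N hπ),
      Subgroup.card_top] at h1
    exact h1
  obtain ⟨A, hA⟩ := exists_card_sq_eq β hβ hβalt
  have := Fact.mk hr
  obtain ⟨k, hk⟩ := IsPGroup.iff_card.1
    (show IsPGroup r (M ⧸ Z.subgroupOf M) from fun b => ⟨1, by rw [pow_one, hBr]⟩)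
  obtain ⟨m, -, hm⟩ := (Nat.dvd_prime_pow hr).1 (hk ▸ A.card_subgroup_dvd_card)
  have hN1 : 1 < Nat.card N := by
    have : Nontrivial N := (Subgroup.nontrivial_iff_ne_bot N).2 hN0
    exact Finite.one_lt_card
  set e := Nat.card A with he
  rw [hBN] at hA
  rw [hBN, hA] at hBt
  have he2 : 2 ≤ e := by
    by_contra! h
    have : e ^ 2 ≤ 1 := by interval_cases e <;> norm_num
    omega
  have het : e ≤ t := (Nat.pow_le_pow_iff_left (by norm_num)).1 hBt
  have hrF : r ∣ Nat.card F - 1 := by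
    obtain ⟨x, hx, y, hy, hxy⟩ : ∃ x ∈ M, ∃ y ∈ M, ⁅x, y⁆ ≠ 1 := by
      by_contra! h
      refine hN0 ((Subgroup.eq_bot_iff_forall N).2 fun n hn => ?_)
      obtain ⟨x, rfl⟩ := hπ n
      exact (hπ1 x).2 (hcent x hn fun y hy => commutatorElement_eq_one_iff_mul_comm.1 (h y hy x hn))
    let z : Z := ⟨⁅x, y⁆, hMM x hx y hy⟩
    have hz1 : z ≠ 1 := fun h => hxy (congrArg Subtype.val h)
    have hzr : z ^ r = 1 := by
      apply hι
      rw [map_pow, map_one]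
      have h1 : β ((⟨x, hx⟩ : M) : M ⧸ Z.subgroupOf M) ((⟨y, hy⟩ : M) : M ⧸ Z.subgroupOf M) =
        ι z := rfl
      rw [← h1, ← map_pow, hBr, map_one]
    exact (orderOf_eq_prime hzr hz1 ▸ orderOf_dvd_natCard z).trans hZF
  have hF3 : 3 ≤ Nat.card F := by
    have h1 := Finite.one_lt_card (α := F)
    have h2 := Nat.le_of_dvd (by omega) hrF
    have h3 := hr.two_le
    omega
  have hYnt : Nontrivial Y := IsSimpleModule.nontrivial (actionRing ρ D) Y
  have hYF : Nat.card F ≤ Nat.card Y :=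
    hY D hZD Y ((Submodule.nontrivial_iff_ne_bot).1 hYnt)
  have hNV : Nat.card N < Nat.card V := by
    rw [hA, hVt]
    calc e ^ 2 < 3 ^ e := sq_lt_three_pow e
      _ ≤ Nat.card Y ^ e := Nat.pow_le_pow_left (by omega) e
      _ ≤ Nat.card Y ^ t := Nat.pow_le_pow_right (by omega) het
  have hYV : Nat.card Y < Nat.card V := by
    rw [hVt]
    exact lt_self_pow₀ (by omega) (by omega)
  -- The action on `M / Z`.
  let τ := conjAction π N
  have hNnt : Nontrivial (Additive N) := (Subgroup.nontrivial_iff_ne_bot N).2 hN0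
  have hτ : SharpOrderBound (e ^ 2) τ.ker.index :=
    hA ▸ ih (Additive N) hNV G τ (irrAction_conjAction hπ N hNmin)
  have hτker : ∀ g ∈ τ.ker, ∀ x ∈ M, ⁅g, x⁆ ∈ Z := by
    intro g hg x hx
    have h1 := DFunLike.congr_fun (MonoidHom.mem_ker.1 hg) (Additive.ofMul (⟨π x, hx⟩ : N))
    have h2 : π g * π x * (π g)⁻¹ = π x :=
      congrArg (fun y : Additive N => ((y.toMul : N) : G ⧸ Z)) h1
    rw [← hπ1, map_commutatorElement]
    exact commutatorElement_eq_one_iff_mul_comm.2 (mul_inv_eq_iff_eq_mul.1 h2)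
  -- The action on `Y`.
  have hYinv : ∀ g ∈ D, ∀ w ∈ Y.toAddSubgroup, ρ g w ∈ Y.toAddSubgroup :=
    fun g hg w hw => apply_mem_of_mem Y hg hw
  let ψ := restrictAction Y.toAddSubgroup hYinv
  have hψker : ψ.ker = ⊥ := by
    rw [Subgroup.eq_bot_iff_forall]
    intro g hg
    refine Subtype.ext (hfaith g g.2 fun y hy => ?_)
    exact congrArg Subtype.val (DFunLike.congr_fun (MonoidHom.mem_ker.1 hg)
      (⟨y, hy⟩ : Y.toAddSubgroup))
  have hYnt' : Nontrivial Y.toAddSubgroup := hYnt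
  have hψ : SharpOrderBound (Nat.card Y) (Nat.card D) := by
    have h1 := ih Y.toAddSubgroup hYV D ψ (IrrAction.of_isSimpleModule hYs hYinv)
    rwa [hψker, Subgroup.index_bot] at h1
  -- The characters of `M / Z` induced by the elements acting trivially on `M / Z` and on `Z`.
  let P : Subgroup G := τ.ker ⊓ C
  have hDP : D ≤ P := by
    intro g hg
    refine ⟨MonoidHom.mem_ker.2 (AddMonoidHom.ext fun y => ?_), ?_⟩
    · obtain ⟨x, hx⟩ := hπ ((y.toMul : N) : G ⧸ Z)
      have hxM : x ∈ M := by
        change π x ∈ N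
        rw [hx]; exact y.toMul.2
      refine congrArg Additive.ofMul (Subtype.ext (a2 := y.toMul) ?_)
      change π g * (y.toMul : N) * (π g)⁻¹ = (y.toMul : N)
      rw [← hx, ← map_mul, ← hMD x hxM g hg, map_mul, mul_inv_cancel_right]
    · exact Subgroup.mem_centralizer_iff.2 fun z hz =>
        Subgroup.mem_centralizer_iff.1 hg z (hZM hz)
  let κ' := commutatorPairing (P := P) ι (fun g hg x hx => hτker g hg.1 x hx)
    (fun g hg => hCZ g hg.2) hMZ
  have hκ' : κ'.ker = D.subgroupOf P := by
    ext g
    rw [mem_ker_commutatorPairing hι, Subgroup.mem_subgroupOf, Subgroup.mem_centralizer_iff]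
    exact ⟨fun h x hx => (h x hx).symm, fun h x hx => (h x hx).symm⟩
  have hDPdvd : D.relIndex P ∣ e ^ 2 := by
    have h1 := index_ker_dvd_of_exponent hr hBr κ'
    rwa [hκ', hBN, hA] at h1
  have hPdvd : P.relIndex τ.ker ∣ a := by
    rw [Subgroup.inf_relIndex_left]
    exact (Subgroup.relIndex_dvd_index_of_normal C τ.ker).trans hC
  have hcard : Nat.card G = τ.ker.index * P.relIndex τ.ker * D.relIndex P * Nat.card D := by
    rw [← D.index_mul_card, ← Subgroup.relIndex_mul_index hDP,
      ← Subgroup.relIndex_mul_index (inf_le_left : P ≤ τ.ker)]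
    ring
  refine SharpOrderBound.of_primitive (x := τ.ker.index) (d := Nat.card D) hr hm he2 hrF hF
    hp.two_le hF3 hYF het hVt (hV ▸ dvd_pow_self _ hd) hτ
    hψ.toOrderBound ?_ ?_
  · rw [hcard]
    exact Nat.mul_dvd_mul (Nat.mul_dvd_mul (Nat.mul_dvd_mul dvd_rfl hPdvd) hDPdvd) dvd_rfl
  · exact mul_ne_zero (mul_ne_zero (mul_ne_zero Subgroup.index_ne_zero_of_finite ha)
      (pow_ne_zero 2 (by omega))) Nat.card_pos.ne'

end Primitive

/-! ### Irreducible and completely reducible actions -/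

section Induction

universe u

/-- A group of order `4` has a group of automorphisms of order dividing `6`. -/
theorem SharpOrderBound.of_card_eq_four {G V : Type*} [Group G] [Finite G] [AddCommGroup V]
    {ρ : G →* AddMonoid.End V} (hinj : Function.Injective ρ) (hV : Nat.card V = 4) :
    SharpOrderBound (Nat.card V) (Nat.card G) := by
  have hfin : Finite V := Nat.finite_of_card_ne_zero (by omega)
  let inst : MulAction G {v : V // v ≠ 0} :=
    { smul := fun g v => ⟨ρ g v, fun h => v.2 (by
        rw [← map_inv_apply_map_apply (ρ := ρ) g (v : V), h, map_zero])⟩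
      one_smul := fun v => Subtype.ext (by
        change ρ 1 (v : V) = v
        rw [map_one]; rfl)
      mul_smul := fun g h v => Subtype.ext (by
        change ρ (g * h) (v : V) = ρ g (ρ h v)
        rw [map_mul]; rfl) }
  have h0 : ∀ g, MulAction.toPermHom G {v : V // v ≠ 0} g = 1 → g = 1 := by
    refine fun g hg => hinj ((AddMonoidHom.ext fun v => ?_).trans (map_one ρ).symm)
    by_cases hv : v = 0
    · rw [hv]; exact map_zero (ρ g)
    · exact congrArg Subtype.val (DFunLike.congr_fun hg (⟨v, hv⟩ : {v : V // v ≠ 0}))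
  have h3 : Nat.card {v : V // v ≠ 0} = 3 := by
    have h1 := Set.ncard_add_ncard_compl ({0} : Set V)
    rw [Set.ncard_singleton, hV] at h1
    change Set.ncard ({0}ᶜ : Set V) = 3
    omega
  have hdvd : Nat.card G ∣ 6 := by
    have h1 := Subgroup.card_dvd_of_injective _ ((injective_iff_map_eq_one _).2 h0)
    rwa [Nat.card_perm, h3] at h1
  rw [hV]
  refine SharpOrderBound.of_dvd ?_ (by norm_num) hdvd
  have h2 : ordCompl[2] 6 ≤ 3 := ordCompl_pow_mul_le Nat.prime_two 1 3
  have h3 : ordCompl[3] 6 ≤ 2 := ordCompl_pow_mul_le Nat.prime_three 1 2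
  refine ⟨⟨?_, ?_, fun h => absurd h (by decide)⟩, fun _ => h3, fun h => absurd h (by decide)⟩
  · exact (Nat.mul_le_mul_left 24 (Nat.pow_le_pow_left h2 3)).trans (by norm_num)
  · exact (Nat.mul_le_mul_left 24 (Nat.pow_le_pow_left h3 3)).trans (by norm_num)

/-- The bounds for irreducible actions, by induction on the order of the module. -/
theorem boundBelow (n : ℕ) : BoundBelow.{u} n := by
  induction n with
  | zero => exact fun W _ _ _ h => absurd h (Nat.not_lt_zero _)
  | succ n ih =>
    intro V _ _ _ hV G _ _ _ ρ hirr
    rcases (Nat.lt_succ_iff.1 hV).lt_or_eq with h | rfl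
    · exact ih V h G ρ hirr
    let ρ' : G ⧸ ρ.ker →* AddMonoid.End V := QuotientGroup.lift ρ.ker ρ le_rfl
    have hinj : Function.Injective ρ' := by
      rw [injective_iff_map_eq_one]
      intro q hq
      obtain ⟨g, rfl⟩ := QuotientGroup.mk_surjective q
      exact (QuotientGroup.eq_one_iff g).2 hq
    have hirr' : IrrAction ρ' := fun W hW => hirr W fun g => hW (g : G ⧸ ρ.ker)
    have hsol : Group.IsSolvable (G ⧸ ρ.ker) := inferInstance
    change SharpOrderBound _ (Nat.card (G ⧸ ρ.ker))
    by_cases hV4 : Nat.card V = 4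
    · exact SharpOrderBound.of_card_eq_four hinj hV4
    by_cases hiso : ∀ (N : Subgroup (G ⧸ ρ.ker)) [N.Normal], IsIsotypic (actionRing ρ' N) V
    · exact SharpOrderBound.of_isotypic hirr' hinj hV4 ih hiso
    · push Not at hiso
      obtain ⟨N, hN, hNi⟩ := hiso
      exact SharpOrderBound.of_not_isotypic hirr' hinj hV4 ih N hNi

/-- The bounds for completely reducible actions: each simple summand of `V` is an irreducible
action, and the group embeds into the product of the groups induced on the summands. -/
theorem OrderBound.of_isSemisimpleModule {G V : Type u} [Group G] [Finite G] [Group.IsSolvable G]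
    [AddCommGroup V] [Finite V] [Nontrivial V] {ρ : G →* AddMonoid.End V}
    (hinj : Function.Injective ρ) [IsSemisimpleModule (actionRing ρ ⊤) V] :
    OrderBound (Nat.card V) (Nat.card G) := by
  classical
  obtain ⟨s, hs, hsup, hsimple⟩ :=
    IsSemisimpleModule.exists_sSupIndep_sSup_simples_eq_top (actionRing ρ ⊤) V
  have hfin : Finite (Submodule (actionRing ρ ⊤) V) :=
    Finite.of_injective _ (SetLike.coe_injective (A := Submodule (actionRing ρ ⊤) V) (B := V))
  have : Fintype s := Fintype.ofFinite s
  rw [sSup_eq_iSup'] at hsup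
  have hne : Nonempty s := by
    by_contra h
    rw [not_nonempty_iff] at h
    rw [iSup_of_empty] at hsup
    exact bot_ne_top hsup
  have hinv : ∀ W : s, ∀ g ∈ (⊤ : Subgroup G), ∀ w ∈ W.1.toAddSubgroup,
      ρ g w ∈ W.1.toAddSubgroup := fun W g hg w hw => apply_mem_of_mem W.1 hg hw
  let ψ : ∀ W : s, (⊤ : Subgroup G) →* AddMonoid.End W.1.toAddSubgroup :=
    fun W => restrictAction W.1.toAddSubgroup (hinv W)
  refine OrderBound.of_prod (ι := s) (s := 1) (w := fun W => Nat.card W.1)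
    (k := fun W => (ψ W).ker.index) ?_ (fun W => ?_)
    (card_eq_prod_card _ ((sSupIndep_iff s).1 hs) hsup) ?_ ?_
  · rw [one_pow]; exact Nat.one_le_pow _ _ (by norm_num)
  · have := hsimple W.1 W.2
    have : Nontrivial W.1.toAddSubgroup := IsSimpleModule.nontrivial (actionRing ρ ⊤) W.1
    exact (boundBelow _ W.1.toAddSubgroup (Nat.lt_succ_self _) _ (ψ W)
      (IrrAction.of_isSimpleModule (hsimple W.1 W.2) (hinv W))).toOrderBound
  · have h := card_dvd_index_mul_prod (⊤ : Subgroup G) (fun _ : s => ⊤) (fun _ => le_rfl) ψ ?_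
    · rwa [Subgroup.index_top] at h
    intro g hg h
    apply hinj
    rw [map_one]
    refine AddMonoidHom.ext fun v => ?_
    have hv : v ∈ ⨆ W : s, W.1 := hsup ▸ Submodule.mem_top
    refine Submodule.iSup_induction _ (motive := fun v => ρ g v = v) hv ?_ (map_zero _) ?_
    · exact fun W w hw => congrArg Subtype.val
        (DFunLike.congr_fun (h W hg) (⟨w, hw⟩ : W.1.toAddSubgroup))
    · exact fun x y hx hy => (map_add _ x y).trans (by rw [hx, hy])
  · exact mul_ne_zero one_ne_zero
      (Finset.prod_ne_zero_iff.2 fun W _ => Subgroup.index_ne_zero_of_finite)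

end Induction

/-! ### Completely reducible representations -/

/-- The scalars join the group, so that invariant subgroups become subrepresentations. -/
theorem Representation.orderBound {G k V : Type*} [Group G] [Finite G] [Group.IsSolvable G]
    [Field k] [AddCommGroup V] [Module k V] [Finite V] [Nontrivial V] (ρ : Representation k G V)
    (hinj : Function.Injective ρ) (hcr : ρ.IsSemisimpleRepresentation) :
    OrderBound (Nat.card V) (Nat.card G) := by
  obtain ⟨v₀, hv₀⟩ := exists_ne (0 : V)
  have hk : Finite k := Finite.of_injective (fun a : k => a • v₀) (smul_left_injective k hv₀)
  let ρ' : G →* AddMonoid.End V :=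
    { toFun := fun g => (ρ g).toAddMonoidHom
      map_one' := AddMonoidHom.ext fun v => LinearMap.congr_fun (map_one ρ) v
      map_mul' := fun g h => AddMonoidHom.ext fun v => LinearMap.congr_fun (map_mul ρ g h) v }
  let φ₁ : G →* (AddMonoid.End V)ˣ := ρ'.toHomUnits
  let φ₂ : kˣ →* (AddMonoid.End V)ˣ := Units.map (Module.toAddMonoidEnd k V)
  have hcomm : ∀ g a, Commute (φ₁ g) (φ₂ a) := fun g a =>
    Units.ext (AddMonoidHom.ext fun v => (map_smul (ρ g) (a : k) v :))
  let φ : G × kˣ →* (AddMonoid.End V)ˣ := φ₁.noncommCoprod φ₂ hcomm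
  have hsol : Group.IsSolvable φ.range :=
    Group.isSolvable_of_surjective φ.rangeRestrict_surjective
  have hfin : Finite φ.range := Finite.of_surjective _ φ.rangeRestrict_surjective
  let σ : φ.range →* AddMonoid.End V := (Units.coeHom _).comp φ.range.subtype
  have hσ : Function.Injective σ := fun x y h => Subtype.ext (Units.ext h)
  have hmem₁ : ∀ g, φ₁ g ∈ φ.range := fun g => ⟨(g, 1), by simp [φ]⟩
  have hmem₂ : ∀ a, φ₂ a ∈ φ.range := fun a => ⟨(1, a), by simp [φ]⟩
  have hss : IsSemisimpleModule (actionRing σ ⊤) V := by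
    rw [isSemisimpleModule_iff]
    refine ⟨fun W => ?_⟩
    let W' : Subrepresentation ρ :=
      { toSubmodule :=
          { W.toAddSubgroup with
            smul_mem' := fun a w hw => by
              by_cases ha : a = 0
              · rw [ha, zero_smul]; exact W.zero_mem
              · exact apply_mem_of_mem (g := ⟨φ₂ (Units.mk0 a ha), hmem₂ _⟩) W
                  (Subgroup.mem_top _) hw }
        apply_mem_toSubmodule := fun g w hw =>
          apply_mem_of_mem (g := ⟨φ₁ g, hmem₁ g⟩) W (Subgroup.mem_top _) hw }
    obtain ⟨U', hU⟩ := hcr.exists_isCompl W'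
    let U : Submodule (actionRing σ ⊤) V := invariantSubmodule U'.toSubmodule.toAddSubgroup (by
      rintro ⟨_, ⟨⟨g, a⟩, rfl⟩⟩ - w hw
      exact U'.apply_mem_toSubmodule g (U'.toSubmodule.smul_mem (a : k) hw))
    have hinf : W'.toSubmodule ⊓ U'.toSubmodule = ⊥ :=
      congrArg Subrepresentation.toSubmodule hU.inf_eq_bot
    have hsup : W'.toSubmodule ⊔ U'.toSubmodule = ⊤ :=
      congrArg Subrepresentation.toSubmodule hU.sup_eq_top
    refine ⟨U, IsCompl.of_eq ?_ ?_⟩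
    · rw [Submodule.eq_bot_iff]
      intro v hv
      have : v ∈ W'.toSubmodule ⊓ U'.toSubmodule := hv
      rwa [hinf, Submodule.mem_bot] at this
    · rw [Submodule.eq_top_iff']
      intro v
      have : v ∈ W'.toSubmodule ⊔ U'.toSubmodule := hsup ▸ Submodule.mem_top
      obtain ⟨w, hw, u, hu, rfl⟩ := Submodule.mem_sup.1 this
      exact Submodule.mem_sup.2 ⟨w, hw, u, hu, rfl⟩
  have hcard : Nat.card G ∣ Nat.card φ.range := by
    refine Subgroup.card_dvd_of_injective (φ₁.codRestrict φ.range hmem₁) fun g h hgh => hinj ?_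
    refine LinearMap.ext fun v => ?_
    exact congrArg (fun x : φ.range => σ x v) hgh
  exact (OrderBound.of_isSemisimpleModule hσ).of_dvd Nat.card_pos.ne' hcard

/-! ### The bounds over the real numbers -/

theorem lam_pos : 0 < lam := Real.rpow_pos_of_pos (by norm_num) _

theorem lam_pow_three : lam ^ 3 = 24 := by
  rw [lam, ← Real.rpow_natCast, ← Real.rpow_mul (by norm_num)]
  norm_num

theorem le_sq_div_lam {h v : ℕ} (hv : 24 * h ^ 3 ≤ v ^ 6) : (h : ℝ) ≤ (v : ℝ) ^ 2 / lam := by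
  rw [le_div_iff₀ lam_pos]
  refine (pow_le_pow_iff_left₀ (mul_nonneg h.cast_nonneg lam_pos.le) (sq_nonneg _)
    (by norm_num : 3 ≠ 0)).1 ?_
  rw [mul_pow, lam_pow_three, ← pow_mul, mul_comm]
  exact_mod_cast hv

theorem le_rpow_div_lam {h v : ℕ} (hv : 576 * h ^ 6 ≤ v ^ 9) :
    (h : ℝ) ≤ (v : ℝ) ^ (3 / 2 : ℝ) / lam := by
  rw [le_div_iff₀ lam_pos]
  refine (pow_le_pow_iff_left₀ (mul_nonneg h.cast_nonneg lam_pos.le)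
    (Real.rpow_nonneg v.cast_nonneg _) (by norm_num : 6 ≠ 0)).1 ?_
  have h1 : ((v : ℝ) ^ (3 / 2 : ℝ)) ^ 6 = (v : ℝ) ^ 9 := by
    rw [← Real.rpow_natCast, ← Real.rpow_mul v.cast_nonneg, ← Real.rpow_natCast]
    norm_num
  have h2 : lam ^ 6 = 576 := by
    rw [show 6 = 3 * 2 from rfl, pow_mul, lam_pow_three]; norm_num
  rw [mul_pow, h1, h2, mul_comm]
  exact_mod_cast hv

/-- An element of order `2` in `V` would be killed by the unit `2` of `k`. -/
theorem odd_card_of_charP {p : ℕ} {k V : Type*} [Field k] [CharP k p] (hp2 : p ≠ 2)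
    [AddCommGroup V] [Module k V] [Finite V] : Odd (Nat.card V) := by
  rw [← Nat.not_even_iff_odd, even_iff_two_dvd]
  intro h
  have := Fact.mk Nat.prime_two
  obtain ⟨v, hv⟩ := exists_prime_addOrderOf_dvd_card' 2 h
  have hv0 : v ≠ 0 := by
    rintro rfl
    rw [addOrderOf_zero] at hv
    omega
  have h2 : ((2 : ℕ) : k) • v = 0 := by
    rw [Nat.cast_smul_eq_nsmul, ← hv, addOrderOf_nsmul_eq_zero]
  have h2k : ((2 : ℕ) : k) = 0 := (smul_eq_zero.1 h2).resolve_right hv0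
  rcases (Nat.dvd_prime Nat.prime_two).1 ((CharP.cast_eq_zero_iff k p 2).1 h2k) with h1 | h1
  · exact CharP.char_ne_one k p h1
  · exact hp2 h1

theorem ordCompl_of_not_dvd {q n : ℕ} (h : ¬ q ∣ n) : ordCompl[q] n = n := by
  rw [Nat.factorization_eq_zero_of_not_dvd h, pow_zero, Nat.div_one]

theorem proposition2p1
    {G : Type*} [Group G] [Finite G] (hG : Group.IsSolvable G)
    (p : ℕ) (hp : 0 < p)
    {k : Type*} [Field k] [CharP k p]
    {V : Type*} [AddCommGroup V] [Module k V] [Finite V] [Nontrivial V]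
    (ρ : Representation k G V)
    (hfaithful : Function.Injective ρ)
    (hcr : ρ.IsSemisimpleRepresentation)
    (H : Subgroup G) :
    ((¬ 2 ∣ Nat.card H ∨ ¬ 3 ∣ Nat.card H) →
      (Nat.card H : ℝ) ≤ (Nat.card V : ℝ) ^ 2 / lam) ∧
    ((¬ 2 ∣ Nat.card H ∧ p ≠ 2) →
      (Nat.card H : ℝ) ≤ (Nat.card V : ℝ) ^ (3 / 2 : ℝ) / lam) := by
  have hb : OrderBound (Nat.card V) (Nat.card H) :=
    (ρ.orderBound hfaithful hcr).of_dvd Nat.card_pos.ne' H.card_subgroup_dvd_card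
  refine ⟨?_, fun ⟨h2, hp2⟩ => le_rpow_div_lam ?_⟩
  · rintro (h | h) <;> refine le_sq_div_lam ?_
    · have := hb.two
      rwa [ordCompl_of_not_dvd h] at this
    · have := hb.three
      rwa [ordCompl_of_not_dvd h] at this
  · have := hb.odd (odd_card_of_charP (k := k) hp2)
    rwa [ordCompl_of_not_dvd h2] at this
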